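/- Let $K$ be a field. For integers $n\ge 1$ and $0\le m\le n$ let $S_{n,m}=K[x_1,\ldots,x_n,y_1,\ldots,y_m]$ with the standard grading, let $I_{n,m}=(x_iy_j : 1\le i\le n,\ 1\le j\le m)\subset S_{n,m}$ be the edge ideal of the complete bipartite graph $K_{n,m}$ (so $I_{n,0}=0$), and let $h(n,m)=\operatorname{hdepth}(S_{n,m}/I_{n,m})$. Here the Hilbert depth $\operatorname{hdepth}(M)$ of a finitely generated graded $S_{n,m}$-module $M\neq 0$ is the maximal depth of a finitely generated graded $S_{n,m}$-module $N$ with the same Hilbert series as $M$, and the depth of $N$ is the maximal length of an $N$-regular sequence contained in the ideal $(x_1,\ldots,x_n,y_1,\ldots,y_m)$. Then for every $n\ge 1$: 1. $h(n,m)\ge h(n,m')$ for all $1\le m\le m'\le\lfloor n/2\rfloor$. 2. $h(n,m)\le h(n,m')$ for all $\lceil n/2\rceil\le m\le m'\le n$. 3. $h(n,\lfloor n/2\rfloor)=h(n,\lceil n/2\rceil)=\lceil n/2\rceil$. 4. $h(n,m)\ge h(n,n-m)$ for all $1\le m\le\lfloor n/2\rfloor$. 5. $\lfloor n/2\rfloor\le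 h(n,m)\le h(n,1)$ for all $1\le m\le n$. -/

import Mathlib

open MvPolynomial

universe u v

/-- A finitely generated `ℤ`-graded module over the polynomial ring `K[x_i : i ∈ σ]` with its
standard grading (every variable has degree one): a finitely generated module `carrier` together
with a decomposition `carrier = ⨁ d : ℤ, gr d` into `K`-subspaces such that
`S_i • gr d ⊆ gr (i + d)`. -/
structure FGGradedModule (K : Type u) [Field K] (σ : Type v) where
  carrier : Type (max u v)
  [addCommGroup : AddCommGroup carrier]
  [moduleBase : Module K carrier]
  [module : Module (MvPolynomial σ K) carrier]
  [isScalarTower : IsScalarTower K (MvPolynomial σ K) carrier]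
  [finite : Module.Finite (MvPolynomial σ K) carrier]
  gr : ℤ → Submodule K carrier
  isInternal : DirectSum.IsInternal gr
  smul_mem : ∀ (i : ℕ) (d : ℤ) (f : MvPolynomial σ K) (x : carrier),
    f ∈ homogeneousSubmodule σ K i → x ∈ gr d → f • x ∈ gr ((i : ℤ) + d)

namespace FGGradedModule

attribute [instance] addCommGroup moduleBase module isScalarTower finite

attribute [local instance] MvPolynomial.gradedAlgebra

variable {K : Type u} [Field K] {σ : Type v}

/-- The Hilbert function `d ↦ dim_K M_d`, i.e. the sequence of coefficients of the Hilbert series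
`∑_d (dim_K M_d) t^d`. Two modules have the same Hilbert series iff these functions agree.
(For finitely many variables all the spaces `M_d` are finite-dimensional.) -/
noncomputable def hilbertFunction (M : FGGradedModule K σ) (d : ℤ) : ℕ :=
  Module.finrank K (M.gr d)

/-- The depth of a (nonzero) graded module: the supremum of the lengths of `M`-regular sequences
contained in the graded maximal ideal `(x_i : i ∈ σ)`. -/
noncomputable def depth (M : FGGradedModule K σ) : ℕ∞ :=
  ⨆ (rs : List (MvPolynomial σ K))
    (_ : (∀ r ∈ rs, r ∈ idealOfVars σ K) ∧
      RingTheory.Sequence.IsRegular M.carrier rs), (rs.length : ℕ∞)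

/-- The Hilbert depth of `M`: the maximal depth of a finitely generated graded module `N` with the
same Hilbert series as `M`. -/
noncomputable def hdepth (M : FGGradedModule K σ) : ℕ∞ :=
  ⨆ (N : FGGradedModule K σ) (_ : N.hilbertFunction = M.hilbertFunction), N.depth

/-- The degree `d` part of `S / I`: the image of `S_d` if `d ≥ 0`, and `0` if `d < 0`. -/
noncomputable def quotientGr (I : Ideal (MvPolynomial σ K)) (d : ℤ) :
    Submodule K (MvPolynomial σ K ⧸ I) :=
  if 0 ≤ d then
    (homogeneousSubmodule σ K d.toNat).map (Ideal.Quotient.mkₐ K I).toLinearMap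
  else ⊥

theorem isInternal_quotientGr (I : Ideal (MvPolynomial σ K))
    (hI : I.IsHomogeneous (homogeneousSubmodule σ K)) :
    DirectSum.IsInternal (quotientGr I) := by
  classical
  rw [DirectSum.isInternal_submodule_iff_iSupIndep_and_iSup_eq_top]
  constructor
  · have key : ∀ i : ℤ, 0 ≤ i → ∃ p : (MvPolynomial σ K ⧸ I) →ₗ[K] (MvPolynomial σ K ⧸ I),
        ∀ f : MvPolynomial σ K, p (Ideal.Quotient.mk I f) =
          Ideal.Quotient.mk I (homogeneousComponent i.toNat f) := by
      intro i _
      refine ⟨(Submodule.liftQ (I.restrictScalars K)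
        ((Ideal.Quotient.mkₐ K I).toLinearMap ∘ₗ homogeneousComponent i.toNat) ?_), ?_⟩
      · intro f hf
        have := hI i.toNat (Submodule.restrictScalars_mem K I f |>.1 hf)
        rw [LinearMap.mem_ker]
        simp only [LinearMap.comp_apply, AlgHom.toLinearMap_apply, Ideal.Quotient.mkₐ_eq_mk]
        rw [Ideal.Quotient.eq_zero_iff_mem]
        exact homogeneousComponent_mem_of_mem hI hf _
      · intro f
        rfl
    rw [iSupIndep_def]
    intro i
    rw [Submodule.disjoint_def]
    intro x hx hx'
    by_cases hi : 0 ≤ i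
    · obtain ⟨p, hp⟩ := key i hi
      have h1 : p x = x := by
        rw [quotientGr, if_pos hi] at hx
        obtain ⟨f, hf, rfl⟩ := hx
        simp only [AlgHom.toLinearMap_apply, Ideal.Quotient.mkₐ_eq_mk]
        rw [hp, homogeneousComponent_of_mem hf, if_pos rfl]
      have h2 : (⨆ j, ⨆ (_ : j ≠ i), quotientGr I j) ≤ LinearMap.ker p := by
        refine iSup₂_le fun j hj => ?_
        intro y hy
        rw [LinearMap.mem_ker]
        by_cases hj0 : 0 ≤ j
        · rw [quotientGr, if_pos hj0] at hy
          obtain ⟨f, hf, rfl⟩ := hy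
          simp only [AlgHom.toLinearMap_apply, Ideal.Quotient.mkₐ_eq_mk]
          rw [hp, homogeneousComponent_of_mem hf, if_neg (by omega), map_zero]
        · rw [quotientGr, if_neg hj0] at hy
          rw [(Submodule.mem_bot K).1 hy, map_zero]
      rw [← h1]
      exact h2 hx'
    · rw [quotientGr, if_neg hi] at hx
      exact (Submodule.mem_bot K).1 hx
  · rw [eq_top_iff]
    rintro x -
    obtain ⟨f, rfl⟩ := Ideal.Quotient.mk_surjective x
    rw [← sum_homogeneousComponent f, map_sum]
    refine Submodule.sum_mem _ fun i _ => ?_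
    refine Submodule.mem_iSup_of_mem (i : ℤ) ?_
    rw [quotientGr, if_pos (by omega)]
    exact ⟨_, homogeneousComponent_mem i f, rfl⟩

theorem smul_mem_quotientGr (I : Ideal (MvPolynomial σ K)) (i : ℕ) (d : ℤ)
    (f : MvPolynomial σ K) (x : MvPolynomial σ K ⧸ I)
    (hf : f ∈ homogeneousSubmodule σ K i) (hx : x ∈ quotientGr I d) :
    f • x ∈ quotientGr I ((i : ℤ) + d) := by
  by_cases hd : 0 ≤ d
  · rw [quotientGr, if_pos hd] at hx
    obtain ⟨g, hg, rfl⟩ := hx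
    rw [quotientGr, if_pos (by omega)]
    refine ⟨f * g, ?_, rfl⟩
    have h : ((i : ℤ) + d).toNat = i + d.toNat := by omega
    rw [h]
    exact IsHomogeneous.mul hf hg
  · rw [quotientGr, if_neg hd] at hx
    rw [(Submodule.mem_bot K).1 hx, smul_zero]
    exact Submodule.zero_mem _

/-- The graded module `S / I` for a homogeneous ideal `I` of `S = K[x_i : i ∈ σ]`. -/
noncomputable def quotient (I : Ideal (MvPolynomial σ K))
    (hI : I.IsHomogeneous (homogeneousSubmodule σ K)) : FGGradedModule K σ where
  carrier := MvPolynomial σ K ⧸ I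
  gr := quotientGr I
  isInternal := isInternal_quotientGr I hI
  smul_mem := smul_mem_quotientGr I

end FGGradedModule

/-- The edge ideal `I_{n,m} = (x_i y_j : i ≤ n, j ≤ m)` of the complete bipartite graph `K_{n,m}` in
`S_{n,m} = K[x_1, …, x_n, y_1, …, y_m]`; the variables indexed by `Sum.inl` are the `x_i`, those
indexed by `Sum.inr` are the `y_j`. -/
noncomputable def bipartiteEdgeIdeal (K : Type u) [Field K] (n m : ℕ) :
    Ideal (MvPolynomial (Fin n ⊕ Fin m) K) :=
  Ideal.span {f | ∃ (i : Fin n) (j : Fin m), f = X (Sum.inl i) * X (Sum.inr j)}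

section

attribute [local instance] MvPolynomial.gradedAlgebra

theorem bipartiteEdgeIdeal_isHomogeneous (K : Type u) [Field K] (n m : ℕ) :
    (bipartiteEdgeIdeal K n m).IsHomogeneous (homogeneousSubmodule (Fin n ⊕ Fin m) K) := by
  refine Ideal.homogeneous_span _ _ ?_
  rintro _ ⟨i, j, rfl⟩
  exact ⟨1 + 1, (isHomogeneous_X K _).mul (isHomogeneous_X K _)⟩

end

/-- `h(n,m) = hdepth (S_{n,m} / I_{n,m})`. -/
noncomputable def bipartiteHdepth (K : Type u) [Field K] (n m : ℕ) : ℕ∞ :=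
  (FGGradedModule.quotient (bipartiteEdgeIdeal K n m)
    (bipartiteEdgeIdeal_isHomogeneous K n m)).hdepth

/-! The Hilbert series of `S/I` is `H = (1 - t)⁻ⁿ + (1 - t)⁻ᵐ - 1`: a surviving monomial involves
only `x`'s or only `y`'s, and `1` is counted twice. The Hilbert depth is the largest `r` for which
`(1 - t)ʳ H` has nonnegative coefficients; `natCast_le_bipartiteHdepth_iff` makes this precise.

Upper bound: after passing to an infinite field, a regular sequence of length `r` on `N` can be
traded for regular linear forms, one at a time, and each quotient by such a form multiplies the
Hilbert series by `1 - t` (`backwardDiff_iterate_nonneg_of_isRegular`). Gradings are carried as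
families of projections, which descend to quotients and extend along base change.

Lower bound: if `(1 - t)ʳ H` is nonnegative, then `H` is a sum of series `tˢ (1 - t)⁻ʲ` with `r ≤ j
≤ n`, hence the Hilbert series of a direct sum of shifted polynomial rings in `j` of the `x`'s, on
which the first `r` of these variables form a regular sequence.

Odd coefficients are automatically nonnegative, so the theorem reduces to the inequalities in
`BipartiteAdmissible` for even `k ≥ 2`. They all hold when `2r ≤ n + 1`; the case `k = 2` alone
forces `r ≤ m` once `n ≤ 2m` (`choose_two_lt`). The five claims follow by comparing binomial
coefficients for different `m`. -/

/-! ### Powers of `1 - t` as integer power series -/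

/-- The power series `∑ₖ ((j, k)) tᵏ = (1 - t)⁻ʲ`. -/
noncomputable def multichooseSeries (j : ℕ) : PowerSeries ℤ :=
  PowerSeries.mk fun k => (Nat.multichoose j k : ℤ)

theorem multichooseSeries_zero : multichooseSeries 0 = 1 := by
  ext k
  cases k with
  | zero => simp [multichooseSeries]
  | succ k => simp [multichooseSeries, PowerSeries.coeff_one]

theorem coeff_succ_one_sub_X_mul (f : PowerSeries ℤ) (k : ℕ) :
    PowerSeries.coeff (k + 1) ((1 - PowerSeries.X) * f) =
      PowerSeries.coeff (k + 1) f - PowerSeries.coeff k f := by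
  rw [sub_mul, one_mul, map_sub, PowerSeries.coeff_succ_X_mul]

theorem coeff_zero_one_sub_X_mul (f : PowerSeries ℤ) :
    PowerSeries.coeff 0 ((1 - PowerSeries.X) * f) = PowerSeries.coeff 0 f := by
  rw [sub_mul, one_mul, map_sub, PowerSeries.coeff_zero_X_mul, sub_zero]

theorem one_sub_X_mul_multichooseSeries (j : ℕ) :
    (1 - PowerSeries.X) * multichooseSeries (j + 1) = multichooseSeries j := by
  ext k
  cases k with
  | zero => rw [coeff_zero_one_sub_X_mul]; simp [multichooseSeries]
  | succ k =>
    rw [coeff_succ_one_sub_X_mul]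
    simp [multichooseSeries, Nat.multichoose_succ_succ]

theorem one_sub_X_pow_mul_multichooseSeries (r j : ℕ) :
    (1 - PowerSeries.X) ^ r * multichooseSeries (r + j) = multichooseSeries j := by
  induction r with
  | zero => simp
  | succ r ih =>
    rw [pow_succ, mul_assoc, show r + 1 + j = r + j + 1 by ring,
      one_sub_X_mul_multichooseSeries, ih]

theorem one_sub_X_pow_mul_multichooseSeries_self (r : ℕ) :
    (1 - PowerSeries.X) ^ r * multichooseSeries r = 1 := by
  simpa [multichooseSeries_zero] using one_sub_X_pow_mul_multichooseSeries r 0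

theorem one_sub_X_pow_add_mul_multichooseSeries (j a : ℕ) :
    (1 - PowerSeries.X) ^ (j + a) * multichooseSeries j = (1 - PowerSeries.X) ^ a := by
  rw [pow_add, mul_right_comm, one_sub_X_pow_mul_multichooseSeries_self, one_mul]

theorem one_sub_X_ne_zero : (1 - PowerSeries.X : PowerSeries ℤ) ≠ 0 := by
  intro h
  have := congrArg (PowerSeries.coeff 0) h
  simp at this

theorem multichooseSeries_mul (r j : ℕ) :
    multichooseSeries r * multichooseSeries j = multichooseSeries (r + j) := by
  apply mul_left_cancel₀ (pow_ne_zero r one_sub_X_ne_zero)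
  rw [one_sub_X_pow_mul_multichooseSeries, ← mul_assoc,
    one_sub_X_pow_mul_multichooseSeries_self, one_mul]

theorem coeff_one_sub_X_pow (r k : ℕ) :
    PowerSeries.coeff k ((1 - PowerSeries.X : PowerSeries ℤ) ^ r) =
      (-1) ^ k * (r.choose k : ℤ) := by
  induction r generalizing k with
  | zero => cases k <;> simp [PowerSeries.coeff_one]
  | succ r ih =>
    rw [pow_succ']
    cases k with
    | zero => rw [coeff_zero_one_sub_X_mul, ih]; simp
    | succ k =>
      rw [coeff_succ_one_sub_X_mul, ih, ih, Nat.choose_succ_succ]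
      push_cast
      ring

/-! ### The numerical criterion -/

/-- The Hilbert series `(1 - t)⁻ⁿ + (1 - t)⁻ᵐ - 1` of `S_{n,m} / I_{n,m}`. -/
noncomputable def bipartiteSeries (n m : ℕ) : PowerSeries ℤ :=
  multichooseSeries n + multichooseSeries m - 1

/-- The numerical condition for `(1 - t)ʳ` times the Hilbert series of `S_{n,m} / I_{n,m}` to have
nonnegative coefficients. -/
def BipartiteAdmissible (n m r : ℕ) : Prop :=
  r ≤ n ∧ ∀ k, Even k → k ≠ 0 →
    r.choose k ≤ (n - r).multichoose k +
      if r ≤ m then (m - r).multichoose k else (r - m).choose k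

theorem coeff_one_sub_X_pow_mul_bipartiteSeries {n m r : ℕ} (hr : r ≤ n) (k : ℕ) :
    PowerSeries.coeff k ((1 - PowerSeries.X) ^ r * bipartiteSeries n m) =
      (n - r).multichoose k +
        (if r ≤ m then ((m - r).multichoose k : ℤ) else (-1) ^ k * ((r - m).choose k : ℤ)) -
        (-1) ^ k * (r.choose k : ℤ) := by
  have h (a : ℕ) (ha : r ≤ a) : (1 - PowerSeries.X) ^ r * multichooseSeries a =
      multichooseSeries (a - r) := by
    conv_lhs => rw [← Nat.add_sub_cancel' ha]
    exact one_sub_X_pow_mul_multichooseSeries r (a - r)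
  rw [bipartiteSeries, mul_sub, mul_add, mul_one, map_sub, map_add, coeff_one_sub_X_pow, h n hr]
  congr 2
  · simp [multichooseSeries]
  · split_ifs with hm
    · rw [h m hm]; simp [multichooseSeries]
    · have := one_sub_X_pow_add_mul_multichooseSeries m (r - m)
      rw [Nat.add_sub_cancel' (by omega)] at this
      rw [this, coeff_one_sub_X_pow]

/-- This is evaluation of `(1 - t)ʳ⁺¹` at `t = 1`: its partial coefficient sums are the coefficients
of `(1 - t)ʳ`, which vanish above degree `r`. -/
theorem sum_coeff_one_sub_X_pow_succ (r N : ℕ) (hN : r < N) :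
    ∑ k ∈ Finset.range (N + 1), PowerSeries.coeff k ((1 - PowerSeries.X : PowerSeries ℤ) ^ (r + 1))
      = 0 := by
  have (N : ℕ) : ∑ k ∈ Finset.range (N + 1),
      PowerSeries.coeff k ((1 - PowerSeries.X : PowerSeries ℤ) ^ (r + 1)) =
      PowerSeries.coeff N ((1 - PowerSeries.X : PowerSeries ℤ) ^ r) := by
    rw [pow_succ']
    induction N with
    | zero => simp only [zero_add, Finset.range_one, Finset.sum_singleton, coeff_zero_one_sub_X_mul]
    | succ N ih => rw [Finset.sum_range_succ, ih, coeff_succ_one_sub_X_mul]; ring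
  rw [this, coeff_one_sub_X_pow, Nat.choose_eq_zero_of_lt hN]
  simp

/-- The point is to exclude `r > n`. In that case the product is a combination of positive powers of
`1 - t`, so its coefficients sum to zero; being nonnegative they all vanish, yet the constant one is
`1 + 1 - 1`. -/
theorem bipartiteAdmissible_of_coeff_nonneg {n m r : ℕ} (hm : m ≤ n)
    (h : ∀ k, 0 ≤ PowerSeries.coeff k ((1 - PowerSeries.X) ^ r * bipartiteSeries n m)) :
    BipartiteAdmissible n m r := by
  by_cases hr : r ≤ n
  · refine ⟨hr, fun k hk _ => ?_⟩
    have := h k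
    rw [coeff_one_sub_X_pow_mul_bipartiteSeries hr, hk.neg_one_pow] at this
    split_ifs at this ⊢ <;> zify <;> linarith
  · exfalso
    obtain ⟨a, rfl⟩ : ∃ a, r = n + (a + 1) := ⟨r - n - 1, by omega⟩
    obtain ⟨b, rfl⟩ : ∃ b, n = m + b := ⟨n - m, by omega⟩
    have hG : (1 - PowerSeries.X) ^ (m + b + (a + 1)) * bipartiteSeries (m + b) m =
        (1 - PowerSeries.X) ^ (a + 1) + (1 - PowerSeries.X) ^ (b + a + 1) -
          (1 - PowerSeries.X) ^ (m + b + a + 1) := by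
      rw [bipartiteSeries, mul_sub, mul_add, mul_one, one_sub_X_pow_add_mul_multichooseSeries,
        show m + b + (a + 1) = m + (b + a + 1) by ring, one_sub_X_pow_add_mul_multichooseSeries,
        show m + (b + a + 1) = m + b + a + 1 by ring]
    rw [hG] at h
    have hs : ∑ k ∈ Finset.range (m + b + a + 1 + 1), PowerSeries.coeff k
        ((1 - PowerSeries.X : PowerSeries ℤ) ^ (a + 1) + (1 - PowerSeries.X) ^ (b + a + 1) -
          (1 - PowerSeries.X) ^ (m + b + a + 1)) = 0 := by
      simp only [map_sub, map_add, Finset.sum_sub_distrib, Finset.sum_add_distrib]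
      rw [sum_coeff_one_sub_X_pow_succ _ _ (by omega), sum_coeff_one_sub_X_pow_succ _ _ (by omega),
        sum_coeff_one_sub_X_pow_succ _ _ (by omega)]
      simp
    have := (Finset.sum_eq_zero_iff_of_nonneg (fun k _ => h k)).1 hs 0 (by simp)
    simp at this

/-- For odd `k` the subtracted `1` contributes `+ C(r, k)`, which outweighs the possible `- C(r - m,
k)`; so only even `k` impose a condition. -/
theorem BipartiteAdmissible.coeff_nonneg {n m r : ℕ} (h : BipartiteAdmissible n m r) (k : ℕ) :
    0 ≤ PowerSeries.coeff k ((1 - PowerSeries.X) ^ r * bipartiteSeries n m) := by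
  rw [coeff_one_sub_X_pow_mul_bipartiteSeries h.1]
  rcases Nat.eq_zero_or_pos k with rfl | hk
  · split_ifs <;> simp
  rcases Nat.even_or_odd k with he | ho
  · have := h.2 k he hk.ne'
    rw [he.neg_one_pow]
    zify at this
    split_ifs at this ⊢ <;> linarith
  · rw [ho.neg_one_pow]
    have := Nat.choose_le_choose k (Nat.sub_le r m)
    zify at this
    split_ifs
    · have : (0 : ℤ) ≤ (n - r).multichoose k + (m - r).multichoose k + r.choose k := by positivity
      linarith
    · have : (0 : ℤ) ≤ (n - r).multichoose k := by positivity
      linarith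

/-! ### Decomposition into shifted series of polynomial rings -/

/-- The Hilbert series that are sums of shifted series `tˢ (1 - t)⁻ʲ` with `a ≤ j ≤ b`. -/
noncomputable def hilbertCone (a b : ℕ) : AddSubmonoid (PowerSeries ℤ) :=
  AddSubmonoid.closure
    {f | ∃ s j, a ≤ j ∧ j ≤ b ∧ f = PowerSeries.X ^ s * multichooseSeries j}

theorem hilbertCone_mono {a b c : ℕ} (h : b ≤ c) : hilbertCone a b ≤ hilbertCone a c :=
  AddSubmonoid.closure_mono fun _ ⟨s, j, h1, h2, e⟩ => ⟨s, j, h1, h2.trans h, e⟩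

theorem multichooseSeries_mul_mem_hilbertCone (c : ℕ) {a b : ℕ} {f : PowerSeries ℤ}
    (hf : f ∈ hilbertCone a b) : multichooseSeries c * f ∈ hilbertCone (c + a) (c + b) := by
  refine AddSubmonoid.closure_induction ?_ ?_ ?_ hf
  · rintro _ ⟨s, j, h1, h2, rfl⟩
    refine AddSubmonoid.subset_closure ⟨s, c + j, by omega, by omega, ?_⟩
    rw [mul_left_comm, multichooseSeries_mul]
  · simp
  · intro x y _ _ hx hy
    rw [mul_add]
    exact add_mem hx hy

theorem X_pow_mul_mem_hilbertCone (c : ℕ) {a b : ℕ} {f : PowerSeries ℤ}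
    (hf : f ∈ hilbertCone a b) : PowerSeries.X ^ c * f ∈ hilbertCone a b := by
  refine AddSubmonoid.closure_induction ?_ ?_ ?_ hf
  · rintro _ ⟨s, j, h1, h2, rfl⟩
    exact AddSubmonoid.subset_closure ⟨c + s, j, h1, h2, by rw [pow_add, mul_assoc]⟩
  · simp
  · intro x y _ _ hx hy
    rw [mul_add]
    exact add_mem hx hy

theorem X_pow_mem_hilbertCone (s b : ℕ) : PowerSeries.X ^ s ∈ hilbertCone 0 b :=
  AddSubmonoid.subset_closure ⟨s, 0, le_rfl, Nat.zero_le _, by rw [multichooseSeries_zero, mul_one]⟩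

/-- Tails of `(1 - t)⁻ᵖ` are sums of shifted series `tˢ (1 - t)⁻ʲ` with `j ≤ p`. -/
theorem tail_multichooseSeries_mem_hilbertCone (p s : ℕ) :
    (PowerSeries.mk fun k => (p.multichoose (s + k) : ℤ)) ∈ hilbertCone 0 p := by
  induction p generalizing s with
  | zero =>
    cases s with
    | zero =>
      have := X_pow_mem_hilbertCone 0 0
      simpa [← multichooseSeries_zero, multichooseSeries] using this
    | succ s =>
      convert zero_mem (hilbertCone 0 0)
      ext k
      simp [show s + 1 + k = s + k + 1 by ring]
  | succ p ih =>
    -- Multiplying the tail by `1 - t` leaves its first coefficient plus `t` times a tail of `(1 -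
    -- t)⁻ᵖ`, by Pascal's rule.
    have key : (PowerSeries.mk fun k => ((p + 1).multichoose (s + k) : ℤ)) =
        multichooseSeries 1 * (((p + 1).multichoose s) • PowerSeries.X ^ 0 +
          PowerSeries.X ^ 1 * PowerSeries.mk fun k => (p.multichoose (s + 1 + k) : ℤ)) := by
      apply mul_left_cancel₀ one_sub_X_ne_zero
      rw [← mul_assoc, one_sub_X_mul_multichooseSeries, multichooseSeries_zero, one_mul]
      ext k
      cases k with
      | zero => rw [coeff_zero_one_sub_X_mul]; simp
      | succ k =>
        rw [coeff_succ_one_sub_X_mul, map_add, pow_one, PowerSeries.coeff_succ_X_mul, map_nsmul,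
          pow_zero, PowerSeries.coeff_one]
        simp [← add_assoc, Nat.multichoose_succ_succ, add_right_comm s 1 k]
    rw [key]
    have := multichooseSeries_mul_mem_hilbertCone 1 (add_mem
      (nsmul_mem (X_pow_mem_hilbertCone 0 p) ((p + 1).multichoose s))
      (X_pow_mul_mem_hilbertCone 1 (ih (s + 1))))
    rw [add_comm 1 p] at this
    refine AddSubmonoid.closure_mono ?_ this
    rintro _ ⟨s, j, h1, h2, e⟩
    exact ⟨s, j, Nat.zero_le _, h2, e⟩

theorem eq_sum_add_X_pow_mul_tail (f : PowerSeries ℤ) (N : ℕ) :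
    f = (∑ k ∈ Finset.range N, PowerSeries.C (PowerSeries.coeff k f) * PowerSeries.X ^ k) +
      PowerSeries.X ^ N * PowerSeries.mk fun k => PowerSeries.coeff (N + k) f := by
  ext d
  rw [map_add, map_sum, PowerSeries.coeff_X_pow_mul']
  simp only [PowerSeries.coeff_C_mul, PowerSeries.coeff_X_pow, mul_ite, mul_one, mul_zero,
    Finset.sum_ite_eq, Finset.mem_range, PowerSeries.coeff_mk]
  split_ifs with h1 h2 h2
  · omega
  · simp
  · rw [Nat.add_sub_cancel' h2]; simp
  · omega

/-- The product `(1 - t)ʳ H` is cut after degree `r`. Below the cut nonnegativity gives multiples of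
`tᵏ`; above it both alternating binomials vanish, leaving tails of `(1 - t)⁻⁽ⁿ⁻ʳ⁾` and possibly `(1
- t)⁻⁽ᵐ⁻ʳ⁾`. Multiplying back by `(1 - t)⁻ʳ` moves the exponents from `[0, n - r]` into `[r, n]`. -/
theorem BipartiteAdmissible.bipartiteSeries_mem_hilbertCone {n m r : ℕ} (hm : m ≤ n)
    (h : BipartiteAdmissible n m r) : bipartiteSeries n m ∈ hilbertCone r n := by
  have hrn := h.1
  have key : (1 - PowerSeries.X) ^ r * bipartiteSeries n m ∈ hilbertCone 0 (n - r) := by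
    rw [eq_sum_add_X_pow_mul_tail ((1 - PowerSeries.X) ^ r * bipartiteSeries n m) (r + 1)]
    refine add_mem (sum_mem fun k _ => ?_) (X_pow_mul_mem_hilbertCone _ ?_)
    · obtain ⟨c, hc⟩ := Int.eq_ofNat_of_zero_le (h.coeff_nonneg k)
      rw [hc]
      have := nsmul_mem (X_pow_mem_hilbertCone k (n - r)) c
      simpa [nsmul_eq_mul] using this
    · have e : (PowerSeries.mk fun k => PowerSeries.coeff (r + 1 + k)
          ((1 - PowerSeries.X) ^ r * bipartiteSeries n m)) =
          (PowerSeries.mk fun k => ((n - r).multichoose (r + 1 + k) : ℤ)) +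
          if r ≤ m then PowerSeries.mk fun k => ((m - r).multichoose (r + 1 + k) : ℤ) else 0 := by
        ext k
        rw [PowerSeries.coeff_mk, coeff_one_sub_X_pow_mul_bipartiteSeries hrn,
          Nat.choose_eq_zero_of_lt (show r < r + 1 + k by omega),
          Nat.choose_eq_zero_of_lt (show r - m < r + 1 + k by omega)]
        split_ifs <;> simp
      rw [e]
      refine add_mem (tail_multichooseSeries_mem_hilbertCone _ _) ?_
      split_ifs
      · exact hilbertCone_mono (by omega) (tail_multichooseSeries_mem_hilbertCone _ _)
      · exact zero_mem _
  have := multichooseSeries_mul_mem_hilbertCone r key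
  rwa [← mul_assoc, mul_comm (multichooseSeries r), one_sub_X_pow_mul_multichooseSeries_self,
    one_mul, add_zero, Nat.add_sub_cancel' hrn] at this

/-! ### Binomial inequalities for admissible `r` -/

theorem choose_le_multichoose {a b k : ℕ} (h : b + 1 ≤ a + k) :
    b.choose k ≤ a.multichoose k := by
  rw [Nat.multichoose_eq]
  exact Nat.choose_le_choose k (by omega)

theorem multichoose_le_choose {a b k : ℕ} (h : a + k ≤ b + 1) :
    a.multichoose k ≤ b.choose k := by
  rw [Nat.multichoose_eq]
  exact Nat.choose_le_choose k (by omega)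

theorem multichoose_mono_left {a b : ℕ} (h : a ≤ b) (k : ℕ) :
    a.multichoose k ≤ b.multichoose k := by
  rw [Nat.multichoose_eq, Nat.multichoose_eq]
  exact Nat.choose_le_choose k (by omega)

namespace BipartiteAdmissible

/-- Since `k ≥ 2`, the first summand `C(n - r + k - 1, k)` already dominates `C(r, k)`. -/
theorem of_two_mul_le {n m r : ℕ} (h : 2 * r ≤ n + 1) (hr : r ≤ n) :
    BipartiteAdmissible n m r := by
  refine ⟨hr, fun k hk h0 => le_add_right (choose_le_multichoose ?_)⟩
  have : 2 ≤ k := by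
    obtain ⟨a, rfl⟩ := hk
    omega
  omega

theorem two_mul_choose_two (a : ℕ) : 2 * a.choose 2 = a * (a - 1) := by
  rw [Nat.choose_two_right]
  exact Nat.mul_div_cancel' (Nat.even_mul_pred_self a).two_dvd

/-- This violates the condition at `k = 2`. With `r = m + u + 1` and `m = u + v + 1` it reduces to
`C(v + 1, 2) + C(u + 1, 2) < C(2u + v + 2, 2)`. -/
theorem choose_two_lt {m n r : ℕ} (hm : 1 ≤ m) (hn : n ≤ 2 * m) (hr : m < r) (hrn : r ≤ n) :
    (n - r).multichoose 2 + (r - m).choose 2 < r.choose 2 := by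
  obtain ⟨u, rfl⟩ : ∃ u, r = m + (u + 1) := ⟨r - m - 1, by omega⟩
  have h1 : (n - (m + (u + 1))).multichoose 2 ≤ (m - u).choose 2 :=
    multichoose_le_choose (by omega)
  obtain ⟨v, rfl⟩ : ∃ v, m = u + (v + 1) := ⟨m - u - 1, by omega⟩
  have e1 := two_mul_choose_two (u + (v + 1) - u)
  have e2 := two_mul_choose_two (u + 1)
  have e3 := two_mul_choose_two (u + (v + 1) + (u + 1))
  simp only [Nat.add_sub_cancel_left, show u + (v + 1) + (u + 1) - 1 = 2 * u + v + 1 by omega,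
    show v + 1 - 1 = v by omega, show u + 1 - 1 = u by omega] at e1 e2 e3 h1 ⊢
  nlinarith

theorem le_of_le_two_mul {n m r : ℕ} (h : BipartiteAdmissible n m r) (hm : 1 ≤ m)
    (hn : n ≤ 2 * m) : r ≤ m := by
  by_contra! hr
  have h1 := h.2 2 even_two two_ne_zero
  rw [if_neg (by omega)] at h1
  exact absurd h1 (not_le.2 (choose_two_lt hm hn hr h.1))

/-- If `r < m'` then `2r ≤ n` and nothing is needed. If `r ≥ m'`, the term depending on `m'` is `C(r
- m', k)`, which grows as `m'` decreases; at `r = m'` both of its forms are zero. -/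
theorem antitone {n m m' r : ℕ} (h : BipartiteAdmissible n m' r) (hm : m ≤ m')
    (hn : 2 * m' ≤ n) : BipartiteAdmissible n m r := by
  rcases lt_or_ge r m' with hr | hr
  · exact of_two_mul_le (by omega) h.1
  refine ⟨h.1, fun k hk h0 => (h.2 k hk h0).trans (Nat.add_le_add_left ?_ _)⟩
  obtain ⟨k, rfl⟩ := Nat.exists_eq_succ_of_ne_zero h0
  split_ifs with h1 h2 h2
  · exact multichoose_mono_left (by omega) _
  · simp [show m' - r = 0 by omega]
  · rw [show r = m by omega]
    simp [show m - m' = 0 by omega]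
  · exact Nat.choose_le_choose _ (by omega)

/-- Here `r ≤ m`, so the second summand is a multichoose coefficient, increasing in `m`. -/
theorem monotone {n m m' r : ℕ} (h : BipartiteAdmissible n m r) (hm1 : 1 ≤ m) (hm : m ≤ m')
    (hn : n ≤ 2 * m) : BipartiteAdmissible n m' r := by
  have hr := h.le_of_le_two_mul hm1 hn
  refine ⟨h.1, fun k hk h0 => (h.2 k hk h0).trans (Nat.add_le_add_left ?_ _)⟩
  rw [if_pos hr, if_pos (hr.trans hm)]
  exact multichoose_mono_left (by omega) _

/-- Admissibility for `n - m` gives `r ≤ n - m`. For `r > m` the term to replace is `C(n - m - r + k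
- 1, k)`, to be bounded by `C(r - m, k)`. This works if `n + k ≤ 2r + 1`; for larger `k` the summand
`C(n - r + k - 1, k)` suffices alone. -/
theorem of_sub {n m r : ℕ} (h : BipartiteAdmissible n (n - m) r) (hm : 1 ≤ m)
    (hn : 2 * m ≤ n) : BipartiteAdmissible n m r := by
  have hr := h.le_of_le_two_mul (by omega) (by omega)
  rcases lt_or_ge m r with hmr | hmr
  · refine ⟨h.1, fun k hk h0 => ?_⟩
    have h1 := h.2 k hk h0
    rw [if_pos hr] at h1
    rw [if_neg (by omega)]
    rcases le_or_gt (n + k) (2 * r + 1) with hk' | hk'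
    · exact h1.trans (Nat.add_le_add_left (multichoose_le_choose (by omega)) _)
    · exact le_add_right (choose_le_multichoose (by omega))
  · exact of_two_mul_le (by omega) h.1

theorem two_mul_choose_pred_le {r k : ℕ} (h : 2 * (k + 1) ≤ r + 1) :
    2 * r.choose k ≤ (r + 1).choose (k + 1) := by
  have e := Nat.add_one_mul_choose_eq r k
  have : 2 * (k + 1) * r.choose k ≤ (k + 1) * (r + 1).choose (k + 1) := by
    calc _ ≤ (r + 1) * r.choose k := Nat.mul_le_mul_right _ h
      _ = _ := by rw [e, mul_comm]
  refine Nat.le_of_mul_le_mul_left ?_ (Nat.succ_pos k)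
  calc _ = 2 * (k + 1) * r.choose k := by rw [Nat.succ_eq_add_one]; ring
    _ ≤ _ := this

/-- Put `p = n - r`. The hypothesis is `C(r, k) ≤ 2 C(p + k - 1, k)`, the goal by Pascal `C(r - 1, k
- 1) ≤ C(p + k - 1, k)`. For `2k ≤ r` the left side is at most half of `C(r, k)`. For `2k > r`, the
case `k = 2` of the hypothesis gives `r ≤ 2p`, so `p + k ≥ r + 1` and the first summand suffices. -/
theorem of_self {n r : ℕ} (h : BipartiteAdmissible n n r) : BipartiteAdmissible n 1 r := by
  rcases le_or_gt r 1 with hr1 | hr1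
  · exact of_two_mul_le (by have := h.1; omega) h.1
  have h2 := h.2 2 even_two two_ne_zero
  rw [if_pos h.1] at h2
  obtain ⟨p, rfl⟩ : ∃ p, n = r + p := ⟨n - r, by have := h.1; omega⟩
  rw [Nat.add_sub_cancel_left] at h2
  have hp : r ≤ 2 * p := by
    by_contra! hlt
    have e1 := two_mul_choose_two r
    have e2 : 2 * p.multichoose 2 = (p + 1) * p := by
      rw [Nat.multichoose_eq, two_mul_choose_two]
      simp
    obtain ⟨q, rfl⟩ : ∃ q, r = q + 2 := ⟨r - 2, by omega⟩
    rw [show q + 2 - 1 = q + 1 by omega] at e1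
    nlinarith
  refine ⟨h.1, fun k hk h0 => ?_⟩
  have hk2 := h.2 k hk h0
  rw [if_pos h.1] at hk2
  rw [if_neg (by omega)]
  rw [Nat.add_sub_cancel_left] at hk2 ⊢
  rcases le_or_gt (2 * k) r with hkr | hkr
  · obtain ⟨k, rfl⟩ := Nat.exists_eq_succ_of_ne_zero h0
    obtain ⟨q, rfl⟩ : ∃ q, r = q + 1 := ⟨r - 1, by omega⟩
    have h3 := two_mul_choose_pred_le hkr
    have h4 := Nat.choose_succ_succ q k
    simp only [Nat.succ_eq_add_one, Nat.add_sub_cancel] at *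
    omega
  · exact le_add_right (choose_le_multichoose (by omega))

theorem le_one {n m r : ℕ} (h : BipartiteAdmissible n m r) (hm1 : 1 ≤ m) (hm : m ≤ n) :
    BipartiteAdmissible n 1 r := by
  rcases le_or_gt (2 * m) n with h2 | h2
  · exact h.antitone hm1 h2
  · rcases hm.eq_or_lt with rfl | hlt
    · exact h.of_self
    · have h3 : BipartiteAdmissible n (n - (n - m)) r := by rwa [Nat.sub_sub_self hm]
      exact (h3.of_sub (by omega) (by omega)).antitone (by omega) (by omega)

/-- For `n ≤ 2m` this is `r ≤ m`. For `n = 2m + 1`, Pascal's rule carries the condition at `k = 2`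
to the pair `(2m, r - 1)`, where `choose_two_lt` refutes it. -/
theorem two_mul_le {n m r : ℕ} (h : BipartiteAdmissible n m r) (h1 : 2 * m ≤ n + 1)
    (h2 : n ≤ 2 * m + 1) : 2 * r ≤ n + 1 := by
  by_contra! hr
  rcases Nat.eq_zero_or_pos m with rfl | hm
  · have := h.1
    omega
  · have h3 := h.2 2 even_two two_ne_zero
    rcases le_or_gt n (2 * m) with h4 | h4
    · have := h.le_of_le_two_mul hm h4
      omega
    · obtain rfl : n = 2 * m + 1 := by omega
      rw [if_neg (by omega)] at h3
      have := choose_two_lt (n := 2 * m) (r := r - 1) hm le_rfl (by omega) (by have := h.1; omega)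
      obtain ⟨s, rfl⟩ : ∃ s, r = s + 1 := ⟨r - 1, by omega⟩
      obtain ⟨t, rfl⟩ : ∃ t, s = m + t := ⟨s - m, by omega⟩
      rw [show 2 * m + 1 - (m + t + 1) = 2 * m - (m + t) by omega,
        show m + t + 1 - m = t + 1 by omega, Nat.choose_succ_succ, Nat.choose_succ_succ] at h3
      rw [Nat.add_sub_cancel, Nat.add_sub_cancel_left] at this
      simp only [Nat.choose_one_right] at h3
      simp only [show Nat.succ 1 = 2 from rfl] at h3
      omega

end BipartiteAdmissible

/-! ### Graded modules and quotients by linear forms -/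

/-- The projections of a graded module over `K[x_i : i ∈ σ]` onto its graded pieces. -/
structure GradingProjections (K : Type u) [Field K] (σ : Type v) (N : Type*) [AddCommGroup N]
    [Module K N] [Module (MvPolynomial σ K) N] where
  proj : ℤ → N →ₗ[K] N
  proj_proj : ∀ d e x, proj d (proj e x) = if d = e then proj e x else 0
  exists_sum : ∀ x, ∃ s : Finset ℤ, ∀ t, s ⊆ t → ∑ d ∈ t, proj d x = x
  proj_X_smul : ∀ d i x,
    proj (d + 1) ((X i : MvPolynomial σ K) • x) = (X i : MvPolynomial σ K) • proj d x

/-- Otherwise the linear forms are covered by the finitely many associated primes. A vector space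
over an infinite field is not a finite union of proper subspaces, so one prime contains every
variable, hence `a`, contradicting regularity. -/
theorem exists_linear_isSMulRegular {K : Type u} [Field K] [Infinite K] {σ : Type v} [Finite σ]
    {N : Type*} [AddCommGroup N] [Module (MvPolynomial σ K) N] [Module.Finite (MvPolynomial σ K) N]
    {a : MvPolynomial σ K} (ha : a ∈ idealOfVars σ K) (hreg : IsSMulRegular N a) :
    ∃ l ∈ homogeneousSubmodule σ K 1, IsSMulRegular N l := by
  by_contra! hl
  have hfin : Finite (associatedPrimes (MvPolynomial σ K) N) :=
    associatedPrimes.finite (MvPolynomial σ K) N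
  have hU := biUnion_associatedPrimes_eq_compl_regular (MvPolynomial σ K) N
  obtain ⟨⟨P, hP⟩, hPt⟩ := Subspace.exists_eq_top_of_iUnion_eq_univ
    (p := fun P : associatedPrimes (MvPolynomial σ K) N =>
      (P.1.restrictScalars K).comap (homogeneousSubmodule σ K 1).subtype) (by
    rw [Set.eq_univ_iff_forall]
    rintro ⟨l, hl'⟩
    have : l ∈ {r : MvPolynomial σ K | IsSMulRegular N r}ᶜ := hl l hl'
    rw [← hU, Set.mem_iUnion₂] at this
    obtain ⟨P, hP, hlP⟩ := this
    exact Set.mem_iUnion.2 ⟨⟨P, hP⟩, hlP⟩)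
  have hle : idealOfVars σ K ≤ P := by
    rw [idealOfVars, Ideal.span_le]
    rintro _ ⟨i, rfl⟩
    have : (⟨X i, isHomogeneous_X K i⟩ : homogeneousSubmodule σ K 1) ∈
        (P.restrictScalars K).comap (homogeneousSubmodule σ K 1).subtype := by
      rw [hPt]
      trivial
    exact this
  have : a ∈ {r : MvPolynomial σ K | IsSMulRegular N r}ᶜ := by
    rw [← hU]
    exact Set.mem_biUnion hP (hle ha)
  exact this hreg

namespace GradingProjections

section Basic

variable {K : Type u} [Field K] {σ : Type v} {N : Type*} [AddCommGroup N] [Module K N]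
  [Module (MvPolynomial σ K) N] (G : GradingProjections K σ N)

theorem eq_zero_of_proj {x : N} (h : ∀ d, G.proj d x = 0) : x = 0 := by
  obtain ⟨s, hs⟩ := G.exists_sum x
  rw [← hs s subset_rfl]
  exact Finset.sum_eq_zero fun d _ => h d

theorem proj_of_mem_range {d : ℤ} {x : N} (h : x ∈ LinearMap.range (G.proj d)) :
    G.proj d x = x := by
  obtain ⟨y, rfl⟩ := h
  rw [G.proj_proj, if_pos rfl]

variable [IsScalarTower K (MvPolynomial σ K) N]

theorem C_smul (a : K) (x : N) : (C a : MvPolynomial σ K) • x = a • x :=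
  algebraMap_smul (MvPolynomial σ K) a x

theorem proj_linear_smul {l : MvPolynomial σ K} (hl : l ∈ homogeneousSubmodule σ K 1) (d : ℤ)
    (x : N) : G.proj (d + 1) (l • x) = l • G.proj d x := by
  rw [homogeneousSubmodule_one_eq_span_X] at hl
  induction hl using Submodule.span_induction with
  | mem l hl =>
    obtain ⟨i, rfl⟩ := hl
    exact G.proj_X_smul d i x
  | zero => simp
  | add a b _ _ ha hb => rw [add_smul, add_smul, map_add, ha, hb]
  | smul c a _ ha => rw [smul_assoc, map_smul, ha, smul_assoc]

/-- Variables raise degree, so on the lowest component a polynomial acts through its constant term.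
-/
theorem proj_smul_of_proj_lt_eq_zero {d : ℤ} {x : N} (hx : ∀ e < d, G.proj e x = 0)
    (f : MvPolynomial σ K) :
    (∀ e < d, G.proj e (f • x) = 0) ∧ G.proj d (f • x) = constantCoeff f • G.proj d x := by
  induction f using MvPolynomial.induction_on with
  | C a =>
    simp only [C_smul, map_smul, constantCoeff_C, and_true]
    intro e he
    rw [hx e he, smul_zero]
  | add p q hp hq =>
    simp only [add_smul, map_add]
    refine ⟨fun e he => ?_, ?_⟩
    · rw [hp.1 e he, hq.1 e he, add_zero]
    · rw [hp.2, hq.2]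
  | mul_X p i hp =>
    have key (e : ℤ) (he : e ≤ d) : G.proj e ((p * X i) • x) = 0 := by
      rw [mul_comm, mul_smul, ← sub_add_cancel e 1, G.proj_X_smul, hp.1 _ (by omega), smul_zero]
    refine ⟨fun e he => key e he.le, ?_⟩
    rw [key d le_rfl, map_mul, constantCoeff_X, mul_zero, zero_smul]

/-- Graded Nakayama lemma. -/
theorem idealOfVars_smul_top_ne_top (G : GradingProjections K σ N)
    [Module.Finite (MvPolynomial σ K) N] [Nontrivial N] :
    idealOfVars σ K • (⊤ : Submodule (MvPolynomial σ K) N) ≠ ⊤ := by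
  intro h
  -- The determinant trick yields an annihilator of `N` with constant term `1`; on a homogeneous
  -- element its lowest component acts as the identity, so every component is zero.
  obtain ⟨r, hr, hr0⟩ := Submodule.exists_sub_one_mem_and_smul_eq_zero_of_fg_of_le_smul
    (idealOfVars σ K) (⊤ : Submodule (MvPolynomial σ K) N) Module.Finite.fg_top h.ge
  have hc : constantCoeff r = 1 := by
    have : idealOfVars σ K ≤ RingHom.ker constantCoeff := by
      rw [idealOfVars, Ideal.span_le]
      rintro _ ⟨i, rfl⟩
      exact constantCoeff_X (R := K) i
    have := this hr
    rw [RingHom.mem_ker, map_sub, map_one] at this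
    exact sub_eq_zero.1 this
  obtain ⟨x, hx⟩ := exists_ne (0 : N)
  refine hx (G.eq_zero_of_proj fun d => ?_)
  have h1 : ∀ e < d, G.proj e (G.proj d x) = 0 := fun e he => by
    rw [G.proj_proj, if_neg he.ne]
  have h2 := (G.proj_smul_of_proj_lt_eq_zero h1 r).2
  rw [hr0 _ trivial, map_zero, hc, one_smul, G.proj_proj, if_pos rfl] at h2
  exact h2.symm

/-- The submodule of elements supported in degrees `≥ d` with degree `d` component in `V`. -/
def truncGE (d : ℤ) (V : Submodule K (LinearMap.range (G.proj d))) :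
    Submodule (MvPolynomial σ K) N where
  carrier := {x | (∀ e < d, G.proj e x = 0) ∧ G.proj d x ∈ V.map (Submodule.subtype _)}
  zero_mem' := by
    simp only [Set.mem_ofPred_eq, map_zero, implies_true, true_and]
    exact zero_mem _
  add_mem' := by
    rintro a b ⟨ha, ha'⟩ ⟨hb, hb'⟩
    refine ⟨fun e he => by rw [map_add, ha e he, hb e he, add_zero], ?_⟩
    rw [map_add]
    exact add_mem ha' hb'
  smul_mem' := by
    rintro f x ⟨hx, hx'⟩
    obtain ⟨h1, h2⟩ := G.proj_smul_of_proj_lt_eq_zero hx f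
    refine ⟨h1, ?_⟩
    rw [h2]
    exact Submodule.smul_mem _ _ hx'

theorem mem_truncGE_of_mem {d : ℤ} {V : Submodule K (LinearMap.range (G.proj d))}
    (x : LinearMap.range (G.proj d)) : (x : N) ∈ G.truncGE d V ↔ x ∈ V := by
  have hx := G.proj_of_mem_range x.2
  constructor
  · rintro ⟨-, h⟩
    rw [hx] at h
    obtain ⟨y, hy, hxy⟩ := h
    rwa [← Subtype.ext hxy]
  · intro h
    refine ⟨fun e he => ?_, ?_⟩
    · rw [← hx, G.proj_proj, if_neg he.ne]
    · rw [hx]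
      exact ⟨x, h, rfl⟩

theorem truncGE_strictMono (d : ℤ) : StrictMono (G.truncGE d) := by
  refine Monotone.strictMono_of_injective ?_ ?_
  · rintro V W h x ⟨h1, h2⟩
    exact ⟨h1, Submodule.map_mono h h2⟩
  · intro V W h
    ext x
    rw [← G.mem_truncGE_of_mem, h, G.mem_truncGE_of_mem]

/-- Subspaces of the degree `d` piece embed, strictly monotonically, into submodules of the
Noetherian module `N`. -/
theorem finite_range_proj [Finite σ] [Module.Finite (MvPolynomial σ K) N] (d : ℤ) :
    Module.Finite K (LinearMap.range (G.proj d)) := by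
  have : IsNoetherian (MvPolynomial σ K) N := inferInstance
  have : WellFoundedGT (Submodule (MvPolynomial σ K) N) := inferInstance
  have : WellFoundedGT (Submodule K (LinearMap.range (G.proj d))) :=
    (G.truncGE_strictMono d).wellFoundedGT
  have : IsNoetherian K (LinearMap.range (G.proj d)) := isNoetherian_iff'.2 this
  infer_instance

theorem proj_linear_smul' {l : MvPolynomial σ K} (hl : l ∈ homogeneousSubmodule σ K 1) (d : ℤ)
    (x : N) : G.proj d (l • x) = l • G.proj (d - 1) x := by
  conv_lhs => rw [← sub_add_cancel d 1]
  exact G.proj_linear_smul hl _ x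

open Pointwise in
/-- The quotient map `N → N / lN` as a `K`-linear map. -/
noncomputable def quotSMulTopMk (l : MvPolynomial σ K) : N →ₗ[K] QuotSMulTop l N :=
  (Submodule.mkQ (l • (⊤ : Submodule (MvPolynomial σ K) N))).restrictScalars K

theorem quotSMulTopMk_surjective (l : MvPolynomial σ K) :
    Function.Surjective (quotSMulTopMk (K := K) (N := N) l) := fun y =>
  Submodule.Quotient.induction_on _ y fun x => ⟨x, rfl⟩

theorem quotSMulTopMk_eq_zero_iff {l : MvPolynomial σ K} {x : N} :
    quotSMulTopMk (K := K) l x = 0 ↔ ∃ y, l • y = x := by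
  refine (Submodule.Quotient.mk_eq_zero _).trans ?_
  rw [Submodule.mem_smul_pointwise_iff_exists]
  simp

/-- The map induced on `N / lN` by the projection onto a graded piece of `N`, for a linear form
`l`. -/
noncomputable def quotSMulTopProj {l : MvPolynomial σ K} (hl : l ∈ homogeneousSubmodule σ K 1)
    (d : ℤ) : QuotSMulTop l N →ₗ[K] QuotSMulTop l N :=
  (LinearMap.ker (quotSMulTopMk (K := K) (N := N) l)).liftQ (quotSMulTopMk l ∘ₗ G.proj d) (by
      intro x hx
      rw [LinearMap.mem_ker, quotSMulTopMk_eq_zero_iff] at hx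
      obtain ⟨y, rfl⟩ := hx
      rw [LinearMap.mem_ker, LinearMap.comp_apply, quotSMulTopMk_eq_zero_iff]
      exact ⟨_, (G.proj_linear_smul' hl d y).symm⟩) ∘ₗ
    ((quotSMulTopMk l).quotKerEquivOfSurjective (quotSMulTopMk_surjective l)).symm.toLinearMap

theorem quotSMulTopProj_mk {l : MvPolynomial σ K} (hl : l ∈ homogeneousSubmodule σ K 1) (d : ℤ)
    (x : N) : G.quotSMulTopProj hl d (quotSMulTopMk l x) = quotSMulTopMk l (G.proj d x) := by
  have : ((quotSMulTopMk (K := K) (N := N) l).quotKerEquivOfSurjective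
      (quotSMulTopMk_surjective l)).symm (quotSMulTopMk l x) = Submodule.Quotient.mk x := by
    rw [LinearEquiv.symm_apply_eq]
    rfl
  rw [quotSMulTopProj, LinearMap.comp_apply, LinearEquiv.coe_coe, this]
  rfl

/-- The grading of `N / lN` for a linear form `l`. -/
noncomputable def quotSMulTop {l : MvPolynomial σ K} (hl : l ∈ homogeneousSubmodule σ K 1) :
    GradingProjections K σ (QuotSMulTop l N) where
  proj := G.quotSMulTopProj hl
  proj_proj d e x := by
    obtain ⟨x, rfl⟩ := quotSMulTopMk_surjective l x
    rw [quotSMulTopProj_mk, quotSMulTopProj_mk, G.proj_proj]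
    split_ifs <;> simp
  exists_sum x := by
    obtain ⟨x, rfl⟩ := quotSMulTopMk_surjective l x
    obtain ⟨s, hs⟩ := G.exists_sum x
    refine ⟨s, fun t ht => ?_⟩
    simp only [quotSMulTopProj_mk]
    rw [← map_sum, hs t ht]
  proj_X_smul d i x := by
    obtain ⟨x, rfl⟩ := quotSMulTopMk_surjective l x
    have e (y : N) : (X i : MvPolynomial σ K) • quotSMulTopMk (K := K) l y =
      quotSMulTopMk l ((X i : MvPolynomial σ K) • y) := rfl
    rw [e, quotSMulTopProj_mk, quotSMulTopProj_mk, e, G.proj_X_smul]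

/-- Dimension count in `0 → N_{d-1} → N_d → (N/lN)_d → 0`, whose first map is multiplication by `l`.
-/
theorem finrank_quotSMulTop [Finite σ] [Module.Finite (MvPolynomial σ K) N]
    {l : MvPolynomial σ K} (hl : l ∈ homogeneousSubmodule σ K 1) (hreg : IsSMulRegular N l)
    (d : ℤ) :
    (Module.finrank K (LinearMap.range ((G.quotSMulTop hl).proj d)) : ℤ) =
      Module.finrank K (LinearMap.range (G.proj d)) -
        Module.finrank K (LinearMap.range (G.proj (d - 1))) := by
  have := G.finite_range_proj d
  set q := quotSMulTopMk (K := K) (N := N) l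
  set A := LinearMap.range (G.proj d)
  have h := (q.domRestrict A).finrank_range_add_finrank_ker
  have h1 : LinearMap.range (q.domRestrict A) = LinearMap.range ((G.quotSMulTop hl).proj d) := by
    ext y
    constructor
    · rintro ⟨⟨_, x, rfl⟩, rfl⟩
      exact ⟨q x, G.quotSMulTopProj_mk hl d x⟩
    · rintro ⟨y, rfl⟩
      obtain ⟨x, rfl⟩ := quotSMulTopMk_surjective l y
      exact ⟨⟨_, x, rfl⟩, (G.quotSMulTopProj_mk hl d x).symm⟩
  let m : N →ₗ[K] N :=
    { toFun := fun x => l • x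
      map_add' := smul_add l
      map_smul' := fun c x => smul_comm l c x }
  have h2 : (LinearMap.ker (q.domRestrict A)).map A.subtype =
      (LinearMap.range (G.proj (d - 1))).map m := by
    ext y
    constructor
    · rintro ⟨⟨x, hx⟩, hk, rfl⟩
      obtain ⟨z, hz⟩ : ∃ z, l • z = x := quotSMulTopMk_eq_zero_iff.1 hk
      refine ⟨G.proj (d - 1) z, ⟨z, rfl⟩, ?_⟩
      change l • G.proj (d - 1) z = x
      rw [← G.proj_linear_smul' hl, hz, G.proj_of_mem_range hx]
    · rintro ⟨_, ⟨z, rfl⟩, rfl⟩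
      refine ⟨⟨l • G.proj (d - 1) z, l • z, G.proj_linear_smul' hl d z⟩, ?_, rfl⟩
      exact quotSMulTopMk_eq_zero_iff.2 ⟨_, rfl⟩
  have h3 := (Submodule.equivMapOfInjective A.subtype A.injective_subtype
    (LinearMap.ker (q.domRestrict A))).finrank_eq
  have h4 := (Submodule.equivMapOfInjective m hreg (LinearMap.range (G.proj (d - 1)))).finrank_eq
  rw [h2] at h3
  rw [h1] at h
  omega

end Basic

end GradingProjections

/-! ### Regular sequences force nonnegative differences -/

/-- The backward difference operator. -/
def backwardDiff (f : ℤ → ℤ) (d : ℤ) : ℤ := f d - f (d - 1)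

/-- Any regular `l ∈ I` may serve as first element. A regular sequence of given length in `I` exists
exactly when certain `Ext` groups into the module vanish below that degree, and the long exact
sequence of multiplication by `l` loses just one degree. -/
theorem exists_isRegular_quotSMulTop {R : Type u} [CommRing R] [IsNoetherianRing R]
    {M : Type u} [AddCommGroup M] [Module R M] [Module.Finite R M] {I : Ideal R}
    (hI : I • (⊤ : Submodule R M) ≠ ⊤) {rs : List R} (hrs : ∀ r ∈ rs, r ∈ I)
    (hreg : RingTheory.Sequence.IsRegular M rs) {n : ℕ} (hn : rs.length = n + 1) {l : R}
    (hl : l ∈ I) (hlreg : IsSMulRegular M l) :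
    ∃ rs' : List R, rs'.length = n ∧ (∀ r ∈ rs', r ∈ I) ∧
      RingTheory.Sequence.IsRegular (QuotSMulTop l M) rs' := by
  have hQ : I • (⊤ : Submodule R (QuotSMulTop l M)) ≠ ⊤ := by
    intro h
    apply hI
    have h1 := congrArg (Submodule.comap (Submodule.mkQ _)) h
    rw [Submodule.comap_smul_top_of_surjective I _ (Submodule.mkQ_surjective _)] at h1
    rw [Submodule.ker_mkQ, Submodule.comap_top, ← Submodule.ideal_span_singleton_smul,
      sup_eq_left.2 (Submodule.smul_mono_left ((Ideal.span_singleton_le_iff_mem I).2 hl))] at h1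
    exact h1
  have e1 := (ModuleCat.exists_isRegular_tfae I (n + 1) (ModuleCat.of R M) hI.lt_top).out 3 1
  have e2 := (ModuleCat.exists_isRegular_tfae I n (ModuleCat.of R (QuotSMulTop l M))
    hQ.lt_top).out 1 3
  have h2 := e1.1 ⟨rs, hn, hrs, hreg⟩
  refine e2.1 fun i hi => ?_
  have z1 := AddCommGrpCat.isZero_of_iff_subsingleton.mpr (h2 i (by omega))
  have z2 := AddCommGrpCat.isZero_of_iff_subsingleton.mpr (h2 (i + 1) (by omega))
  exact AddCommGrpCat.subsingleton_of_isZero <|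
    CategoryTheory.ShortComplex.Exact.isZero_of_both_zeros
      ((CategoryTheory.Abelian.Ext.covariant_sequence_exact₃' _
        (IsSMulRegular.smulShortComplex_shortExact (M := ModuleCat.of R M) hlreg)) i (i + 1) rfl)
      (z1.eq_zero_of_src _) (z2.eq_zero_of_tgt _)

namespace GradingProjections

/-- If a graded module over an infinite field has a regular sequence of length `r` in the graded
maximal ideal, then `(1 - t)ʳ` times its Hilbert series has nonnegative coefficients. -/
theorem backwardDiff_iterate_nonneg {K : Type u} [Field K] [Infinite K] {σ : Type v} [Finite σ]
    (r : ℕ) : ∀ (N : Type max u v) [AddCommGroup N] [Module K N] [Module (MvPolynomial σ K) N]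
    [IsScalarTower K (MvPolynomial σ K) N] [Module.Finite (MvPolynomial σ K) N]
    (G : GradingProjections K σ N) (rs : List (MvPolynomial σ K)), rs.length = r →
    (∀ f ∈ rs, f ∈ idealOfVars σ K) → RingTheory.Sequence.IsRegular N rs → ∀ d,
      0 ≤ backwardDiff^[r] (fun d => (Module.finrank K (LinearMap.range (G.proj d)) : ℤ)) d := by
  induction r with
  | zero =>
    intro N _ _ _ _ _ G rs _ _ _ d
    simp
  | succ r ih =>
    intro N _ _ _ _ _ G rs hlen hrs hreg d
    have := hreg.nontrivial
    obtain ⟨a, as, rfl⟩ := List.exists_cons_of_length_eq_add_one hlen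
    obtain ⟨l, hl, hlreg⟩ := exists_linear_isSMulRegular (hrs a List.mem_cons_self)
      ((RingTheory.Sequence.isRegular_cons_iff _ _ _).1 hreg).1
    have hlI : l ∈ idealOfVars σ K := by
      have : homogeneousSubmodule σ K 1 ≤ (idealOfVars σ K).restrictScalars K := by
        rw [homogeneousSubmodule_one_eq_span_X, Submodule.span_le]
        rintro _ ⟨i, rfl⟩
        exact Ideal.subset_span ⟨i, rfl⟩
      exact this hl
    obtain ⟨rs', hlen', hrs', hreg'⟩ := exists_isRegular_quotSMulTop
      G.idealOfVars_smul_top_ne_top hrs hreg hlen hlI hlreg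
    have h := ih (QuotSMulTop l N) (G.quotSMulTop hl) rs' hlen' hrs' hreg' d
    simp only [G.finrank_quotSMulTop hl hlreg] at h
    exact h

/-! ### Base change to an infinite field -/

section BaseChange

attribute [local instance] MvPolynomial.algebraMvPolynomial

open TensorProduct

variable {K : Type u} [Field K] {σ : Type v} {N : Type*} [AddCommGroup N] [Module K N]
  [Module (MvPolynomial σ K) N] [IsScalarTower K (MvPolynomial σ K) N]
  (G : GradingProjections K σ N) (L : Type u) [Field L] [Algebra K L]

/-- The base change of a module over a polynomial ring along a field extension is the extension of
scalars of the underlying vector space. -/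
noncomputable def baseChangeEquiv (K : Type u) [Field K] (σ : Type v) (N : Type*) [AddCommGroup N]
    [Module K N] [Module (MvPolynomial σ K) N] [IsScalarTower K (MvPolynomial σ K) N]
    (L : Type u) [Field L] [Algebra K L] :
    L ⊗[K] N ≃ₗ[L] MvPolynomial σ L ⊗[MvPolynomial σ K] N :=
  (Algebra.IsPushout.cancelBaseChange K L (MvPolynomial σ K) (MvPolynomial σ L) N).symm

/-- The projections of the base change of a graded module along a field extension. -/
noncomputable def baseChangeProj (d : ℤ) :
    MvPolynomial σ L ⊗[MvPolynomial σ K] N →ₗ[L] MvPolynomial σ L ⊗[MvPolynomial σ K] N :=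
  (baseChangeEquiv K σ N L).conj ((G.proj d).baseChange L)

theorem baseChangeProj_baseChangeEquiv (d : ℤ) (x : L ⊗[K] N) :
    G.baseChangeProj L d (baseChangeEquiv K σ N L x) =
      baseChangeEquiv K σ N L ((G.proj d).baseChange L x) := by
  simp [baseChangeProj, LinearEquiv.conj_apply]

theorem X_smul_baseChangeEquiv_tmul (i : σ) (c : L) (x : N) :
    (X i : MvPolynomial σ L) • baseChangeEquiv K σ N L (c ⊗ₜ x) =
      baseChangeEquiv K σ N L (c ⊗ₜ ((X i : MvPolynomial σ K) • x)) := by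
  rw [baseChangeEquiv, Algebra.IsPushout.cancelBaseChange_symm_tmul,
    Algebra.IsPushout.cancelBaseChange_symm_tmul, TensorProduct.smul_tmul', ←
    TensorProduct.smul_tmul]
  congr 1
  rw [smul_eq_mul, Algebra.smul_def]
  congr 1
  exact (map_X _ i).symm

/-- The grading of the base change of a graded module along a field extension. -/
noncomputable def baseChange :
    GradingProjections L σ (MvPolynomial σ L ⊗[MvPolynomial σ K] N) where
  proj := G.baseChangeProj L
  proj_proj d e x := by
    obtain ⟨x, rfl⟩ := (baseChangeEquiv K σ N L).surjective x
    rw [baseChangeProj_baseChangeEquiv, baseChangeProj_baseChangeEquiv]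
    have : (if d = e then baseChangeEquiv K σ N L ((G.proj e).baseChange L x) else 0) =
        baseChangeEquiv K σ N L (if d = e then (G.proj e).baseChange L x else 0) := by
      split_ifs <;> simp
    rw [this]
    clear this
    congr 1
    induction x with
    | zero => simp
    | add x y hx hy =>
      rw [map_add, map_add, hx, hy]
      split_ifs <;> simp
    | tmul c x =>
      rw [LinearMap.baseChange_tmul, LinearMap.baseChange_tmul, G.proj_proj]
      split_ifs <;> simp
  exists_sum x := by
    obtain ⟨x, rfl⟩ := (baseChangeEquiv K σ N L).surjective x
    simp only [baseChangeProj_baseChangeEquiv, ← map_sum, EmbeddingLike.apply_eq_iff_eq]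
    induction x with
    | zero => exact ⟨∅, fun t _ => by simp⟩
    | add x y hx hy =>
      classical
      obtain ⟨s, hs⟩ := hx
      obtain ⟨s', hs'⟩ := hy
      refine ⟨s ∪ s', fun t ht => ?_⟩
      simp only [map_add, Finset.sum_add_distrib]
      rw [hs t (Finset.union_subset_left ht), hs' t (Finset.union_subset_right ht)]
    | tmul c x =>
      obtain ⟨s, hs⟩ := G.exists_sum x
      refine ⟨s, fun t ht => ?_⟩
      simp only [LinearMap.baseChange_tmul]
      rw [← TensorProduct.tmul_sum, hs t ht]
  proj_X_smul d i x := by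
    obtain ⟨x, rfl⟩ := (baseChangeEquiv K σ N L).surjective x
    induction x with
    | zero => simp
    | add x y hx hy => simp only [map_add, smul_add, hx, hy]
    | tmul c x =>
      rw [X_smul_baseChangeEquiv_tmul, baseChangeProj_baseChangeEquiv,
        baseChangeProj_baseChangeEquiv, LinearMap.baseChange_tmul, LinearMap.baseChange_tmul,
        G.proj_X_smul, X_smul_baseChangeEquiv_tmul]

theorem finrank_baseChange (d : ℤ) :
    Module.finrank L (LinearMap.range ((G.baseChange L).proj d)) =
      Module.finrank K (LinearMap.range (G.proj d)) := by
  set p := G.proj d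
  have hp : p = (LinearMap.range p).subtype ∘ₗ p.rangeRestrict := rfl
  have h1 : LinearMap.range (p.baseChange L) =
      LinearMap.range ((LinearMap.range p).subtype.baseChange L) := by
    conv_lhs => rw [hp, LinearMap.baseChange_comp]
    exact LinearMap.range_comp_of_range_eq_top _ (LinearMap.range_eq_top.2
      (LinearMap.lTensor_surjective L p.surjective_rangeRestrict))
  have h2 : Function.Injective ((LinearMap.range p).subtype.baseChange L) :=
    Module.Flat.lTensor_preserves_injective_linearMap _ (LinearMap.range p).injective_subtype
  have h3 : LinearMap.range ((G.baseChange L).proj d) =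
      (LinearMap.range (p.baseChange L)).map (baseChangeEquiv K σ N L).toLinearMap := by
    ext y
    constructor
    · rintro ⟨y, rfl⟩
      obtain ⟨x, rfl⟩ := (baseChangeEquiv K σ N L).surjective y
      exact ⟨_, ⟨x, rfl⟩, (G.baseChangeProj_baseChangeEquiv L d x).symm⟩
    · rintro ⟨_, ⟨x, rfl⟩, rfl⟩
      exact ⟨_, G.baseChangeProj_baseChangeEquiv L d x⟩
  rw [h3, LinearEquiv.finrank_map_eq, h1, LinearMap.finrank_range_of_inj h2,
    Module.finrank_baseChange]

theorem map_mem_idealOfVars {K L : Type*} [CommRing K] [CommRing L] [Algebra K L] {σ : Type*}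
    {f : MvPolynomial σ K} (hf : f ∈ idealOfVars σ K) :
    algebraMap (MvPolynomial σ K) (MvPolynomial σ L) f ∈ idealOfVars σ L := by
  have : idealOfVars σ K ≤ (idealOfVars σ L).comap
      (algebraMap (MvPolynomial σ K) (MvPolynomial σ L)) := by
    rw [idealOfVars, Ideal.span_le]
    rintro _ ⟨i, rfl⟩
    exact Ideal.subset_span ⟨i, (map_X _ i).symm⟩
  exact this hf

/-- Weak regularity survives by flatness, properness by the graded Nakayama lemma over `L`. -/
theorem isRegular_baseChange [Module.Finite (MvPolynomial σ K) N] {rs : List (MvPolynomial σ K)}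
    (hrs : ∀ f ∈ rs, f ∈ idealOfVars σ K) (hreg : RingTheory.Sequence.IsRegular N rs)
    (G : GradingProjections K σ N) :
    RingTheory.Sequence.IsRegular (MvPolynomial σ L ⊗[MvPolynomial σ K] N)
      (rs.map (algebraMap (MvPolynomial σ K) (MvPolynomial σ L))) := by
  have := hreg.nontrivial
  have : Nontrivial (MvPolynomial σ L ⊗[MvPolynomial σ K] N) :=
    (baseChangeEquiv K σ N L).symm.toEquiv.nontrivial
  have hflat : Module.Flat (MvPolynomial σ K) (MvPolynomial σ L) :=
    Module.Flat.isBaseChange K (MvPolynomial σ K) L (MvPolynomial σ L)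
      (Algebra.IsPushout.out (R := K) (S := MvPolynomial σ K) (R' := L) (S' := MvPolynomial σ L))
  have hb := TensorProduct.isBaseChange (MvPolynomial σ K) N (MvPolynomial σ L)
  have hw := hreg.1.of_flat_of_isBaseChange hb
  have ht := (G.baseChange L).idealOfVars_smul_top_ne_top
  refine ⟨hw, fun h => ht (top_le_iff.1 (h.le.trans (Submodule.smul_mono_left ?_)))⟩
  refine Ideal.span_le.2 fun f hf => ?_
  obtain ⟨g, hg, rfl⟩ := List.mem_map.1 hf
  exact map_mem_idealOfVars (hrs g hg)

theorem backwardDiff_iterate_nonneg_of_infinite_extension [Infinite L] [Finite σ]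
    {M : Type max u v} [AddCommGroup M] [Module K M] [Module (MvPolynomial σ K) M]
    [IsScalarTower K (MvPolynomial σ K) M] [Module.Finite (MvPolynomial σ K) M]
    (G : GradingProjections K σ M) {rs : List (MvPolynomial σ K)}
    (hrs : ∀ f ∈ rs, f ∈ idealOfVars σ K) (hreg : RingTheory.Sequence.IsRegular M rs) (d : ℤ) :
    0 ≤ backwardDiff^[rs.length]
      (fun d => (Module.finrank K (LinearMap.range (G.proj d)) : ℤ)) d := by
  have h := (G.baseChange L).backwardDiff_iterate_nonneg rs.length
    (MvPolynomial σ L ⊗[MvPolynomial σ K] M) _ (by simp)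
    (fun f hf => by
      obtain ⟨g, hg, rfl⟩ := List.mem_map.1 hf
      exact map_mem_idealOfVars (hrs g hg)) (isRegular_baseChange L hrs hreg G) d
  simpa only [finrank_baseChange] using h

end BaseChange

theorem backwardDiff_iterate_nonneg_of_isRegular {K : Type u} [Field K] {σ : Type v} [Finite σ]
    {N : Type max u v} [AddCommGroup N] [Module K N] [Module (MvPolynomial σ K) N]
    [IsScalarTower K (MvPolynomial σ K) N] [Module.Finite (MvPolynomial σ K) N]
    (G : GradingProjections K σ N) {rs : List (MvPolynomial σ K)}
    (hrs : ∀ f ∈ rs, f ∈ idealOfVars σ K) (hreg : RingTheory.Sequence.IsRegular N rs) (d : ℤ) :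
    0 ≤ backwardDiff^[rs.length]
      (fun d => (Module.finrank K (LinearMap.range (G.proj d)) : ℤ)) d :=
  G.backwardDiff_iterate_nonneg_of_infinite_extension (AlgebraicClosure K) hrs hreg d

end GradingProjections

/-! ### Hilbert functions as coefficient functions -/

/-- The coefficients of a power series, extended by zero to negative indices. -/
noncomputable def coeffInt (f : PowerSeries ℤ) (d : ℤ) : ℤ :=
  if 0 ≤ d then PowerSeries.coeff d.toNat f else 0

theorem coeffInt_natCast (f : PowerSeries ℤ) (k : ℕ) : coeffInt f k = PowerSeries.coeff k f := by
  simp [coeffInt]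

theorem coeffInt_of_neg (f : PowerSeries ℤ) {d : ℤ} (h : d < 0) : coeffInt f d = 0 :=
  if_neg (by omega)

theorem coeffInt_add (f g : PowerSeries ℤ) (d : ℤ) :
    coeffInt (f + g) d = coeffInt f d + coeffInt g d := by
  unfold coeffInt
  split_ifs <;> simp

theorem coeffInt_X_pow_mul (f : PowerSeries ℤ) (s : ℕ) (d : ℤ) :
    coeffInt (PowerSeries.X ^ s * f) d = coeffInt f (d - s) := by
  unfold coeffInt
  rw [PowerSeries.coeff_X_pow_mul']
  split_ifs with h1 h2 h3 h3
  · rw [show (d - s).toNat = d.toNat - s by omega]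
  · omega
  · omega
  · rfl
  · omega
  · rfl

theorem backwardDiff_coeffInt (f : PowerSeries ℤ) :
    backwardDiff (coeffInt f) = coeffInt ((1 - PowerSeries.X) * f) := by
  funext d
  rw [backwardDiff]
  rcases lt_trichotomy d 0 with h | rfl | h
  · rw [coeffInt_of_neg _ h, coeffInt_of_neg _ h, coeffInt_of_neg _ (by omega), sub_zero]
  · have h1 (g : PowerSeries ℤ) : coeffInt g 0 = PowerSeries.coeff 0 g := coeffInt_natCast g 0
    rw [h1, h1, coeffInt_of_neg _ (by omega), sub_zero, coeff_zero_one_sub_X_mul]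
  · obtain ⟨k, rfl⟩ : ∃ k : ℕ, d = (k + 1 : ℕ) := ⟨(d - 1).toNat, by omega⟩
    rw [show ((k + 1 : ℕ) : ℤ) - 1 = (k : ℕ) by push_cast; ring, coeffInt_natCast,
      coeffInt_natCast, coeffInt_natCast, coeff_succ_one_sub_X_mul]

theorem backwardDiff_iterate_coeffInt (r : ℕ) (f : PowerSeries ℤ) :
    backwardDiff^[r] (coeffInt f) = coeffInt ((1 - PowerSeries.X) ^ r * f) := by
  induction r generalizing f with
  | zero => simp
  | succ r ih => rw [Function.iterate_succ_apply, backwardDiff_coeffInt, ih, pow_succ, mul_assoc]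

/-! ### Projections, shifts and direct sums -/

namespace FGGradedModule

variable {K : Type u} [Field K] {σ : Type v}

open scoped Classical in
/-- The projections of a graded module onto its graded pieces. -/
noncomputable def projections (M : FGGradedModule K σ) : GradingProjections K σ M.carrier :=
  letI := M.isInternal.chooseDecomposition
  have hsame {d : ℤ} {x : M.carrier} (hx : x ∈ M.gr d) :
      (DirectSum.decompose M.gr x d : M.carrier) = x := DirectSum.decompose_of_mem_same _ hx
  have hne {d e : ℤ} (h : e ≠ d) {x : M.carrier} (hx : x ∈ M.gr e) :
      (DirectSum.decompose M.gr x d : M.carrier) = 0 := DirectSum.decompose_of_mem_ne _ hx h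
  { proj := fun d => (M.gr d).subtype ∘ₗ DirectSum.component K ℤ (fun d => M.gr d) d ∘ₗ
      (DirectSum.decomposeLinearEquiv M.gr).toLinearMap
    proj_proj := fun d e x => by
      split_ifs with h
      · subst h
        exact hsame (SetLike.coe_mem _)
      · exact hne (Ne.symm h) (SetLike.coe_mem _)
    exists_sum := fun x => by
      refine ⟨(DirectSum.decompose M.gr x).support, fun t ht => ?_⟩
      refine (Finset.sum_subset ht fun d _ hd => ?_).symm.trans
        (DirectSum.sum_support_decompose M.gr x)
      rw [DFinsupp.notMem_support_iff] at hd
      exact congrArg Subtype.val hd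
    proj_X_smul := fun d i x => by
      change (DirectSum.decompose M.gr ((X i : MvPolynomial σ K) • x) (d + 1) : M.carrier) =
        (X i : MvPolynomial σ K) • (DirectSum.decompose M.gr x d : M.carrier)
      have hX {e : ℤ} {y : M.carrier} (hy : y ∈ M.gr e) :
          (X i : MvPolynomial σ K) • y ∈ M.gr (e + 1) := by
        have := M.smul_mem 1 e (X i) y (isHomogeneous_X K i) hy
        rwa [Nat.cast_one, add_comm] at this
      induction x using DirectSum.Decomposition.inductionOn M.gr with
      | zero => simp
      | @homogeneous e y =>
        rcases eq_or_ne e d with rfl | h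
        · rw [hsame (hX y.2), hsame y.2]
        · rw [hne (by omega) (hX y.2), hne h y.2, smul_zero]
      | add x y hx hy =>
        simp only [smul_add, DirectSum.decompose_add, DirectSum.add_apply, Submodule.coe_add,
          hx, hy] }

theorem range_projections (M : FGGradedModule K σ) (d : ℤ) :
    LinearMap.range (M.projections.proj d) = M.gr d := by
  classical
  let := M.isInternal.chooseDecomposition
  ext x
  constructor
  · rintro ⟨y, rfl⟩
    exact SetLike.coe_mem _
  · intro hx
    exact ⟨x, DirectSum.decompose_of_mem_same M.gr hx⟩

theorem coeff_nonneg_of_isRegular [Finite σ] (M : FGGradedModule K σ) {f : PowerSeries ℤ}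
    (hf : ∀ d, (M.hilbertFunction d : ℤ) = coeffInt f d) {rs : List (MvPolynomial σ K)}
    (hrs : ∀ r ∈ rs, r ∈ idealOfVars σ K) (hreg : RingTheory.Sequence.IsRegular M.carrier rs)
    (k : ℕ) : 0 ≤ PowerSeries.coeff k ((1 - PowerSeries.X) ^ rs.length * f) := by
  have h := M.projections.backwardDiff_iterate_nonneg_of_isRegular hrs hreg k
  have e : (fun d => (Module.finrank K (LinearMap.range (M.projections.proj d)) : ℤ)) =
      coeffInt f := by
    funext d
    rw [range_projections]
    exact hf d
  rwa [e, backwardDiff_iterate_coeffInt, coeffInt_natCast] at h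

theorem finite_gr [Finite σ] (M : FGGradedModule K σ) (d : ℤ) : Module.Finite K (M.gr d) := by
  rw [← range_projections]
  exact M.projections.finite_range_proj d

/-- The graded module `M(-s)`. -/
def shift (M : FGGradedModule K σ) (s : ℤ) : FGGradedModule K σ where
  carrier := M.carrier
  gr d := M.gr (d - s)
  isInternal := by
    have h := (DirectSum.isInternal_submodule_iff_iSupIndep_and_iSup_eq_top _).1 M.isInternal
    refine (DirectSum.isInternal_submodule_iff_iSupIndep_and_iSup_eq_top _).2
      ⟨h.1.comp (sub_left_injective (b := s)), ?_⟩
    exact ((Equiv.subRight s).iSup_comp (g := M.gr)).trans h.2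
  smul_mem i d f x hf hx := by
    have := M.smul_mem i (d - s) f x hf hx
    rwa [← add_sub_assoc] at this

theorem hilbertFunction_shift (M : FGGradedModule K σ) (s d : ℤ) :
    (M.shift s).hilbertFunction d = M.hilbertFunction (d - s) := rfl

theorem isInternal_prod {V W : Type*} [AddCommGroup V] [Module K V] [AddCommGroup W] [Module K W]
    {A : ℤ → Submodule K V} {B : ℤ → Submodule K W} (hA : DirectSum.IsInternal A)
    (hB : DirectSum.IsInternal B) : DirectSum.IsInternal fun d => (A d).prod (B d) := by
  rw [DirectSum.isInternal_submodule_iff_iSupIndep_and_iSup_eq_top] at hA hB ⊢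
  constructor
  · intro d
    rw [Submodule.disjoint_def]
    rintro ⟨x, y⟩ ⟨hx, hy⟩ h
    have hle : (⨆ e, ⨆ (_ : e ≠ d), (A e).prod (B e)) ≤
        (⨆ e, ⨆ (_ : e ≠ d), A e).prod (⨆ e, ⨆ (_ : e ≠ d), B e) :=
      iSup₂_le fun e he => Submodule.prod_mono (le_iSup₂_of_le e he le_rfl)
        (le_iSup₂_of_le e he le_rfl)
    obtain ⟨h1, h2⟩ := hle h
    exact Prod.ext (Submodule.disjoint_def.1 (hA.1 d) x hx h1)
      (Submodule.disjoint_def.1 (hB.1 d) y hy h2)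
  · rw [eq_top_iff]
    rintro ⟨x, y⟩ -
    have h1 : (⨆ d, A d).map (LinearMap.inl K V W) ≤ ⨆ d, (A d).prod (B d) := by
      rw [Submodule.map_iSup]
      refine iSup_mono fun d => ?_
      rintro _ ⟨z, hz, rfl⟩
      exact ⟨hz, zero_mem _⟩
    have h2 : (⨆ d, B d).map (LinearMap.inr K V W) ≤ ⨆ d, (A d).prod (B d) := by
      rw [Submodule.map_iSup]
      refine iSup_mono fun d => ?_
      rintro _ ⟨z, hz, rfl⟩
      exact ⟨zero_mem _, hz⟩
    rw [hA.2] at h1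
    rw [hB.2] at h2
    have := add_mem (h1 ⟨x, trivial, rfl⟩) (h2 ⟨y, trivial, rfl⟩)
    simpa using this

/-- The direct sum of two graded modules. -/
noncomputable def prod (M N : FGGradedModule K σ) : FGGradedModule K σ where
  carrier := M.carrier × N.carrier
  gr d := (M.gr d).prod (N.gr d)
  isInternal := isInternal_prod M.isInternal N.isInternal
  smul_mem i d f x hf hx := ⟨M.smul_mem i d f x.1 hf hx.1, N.smul_mem i d f x.2 hf hx.2⟩

theorem hilbertFunction_prod [Finite σ] (M N : FGGradedModule K σ) (d : ℤ) :
    (M.prod N).hilbertFunction d = M.hilbertFunction d + N.hilbertFunction d := by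
  have := M.finite_gr d
  have := N.finite_gr d
  let e : (M.gr d).prod (N.gr d) ≃ₗ[K] M.gr d × N.gr d :=
    { toFun := fun x => (⟨x.1.1, x.2.1⟩, ⟨x.1.2, x.2.2⟩)
      invFun := fun x => ⟨(x.1.1, x.2.1), x.1.2, x.2.2⟩
      map_add' := fun _ _ => rfl
      map_smul' := fun _ _ => rfl
      left_inv := fun _ => rfl
      right_inv := fun _ => rfl }
  exact e.finrank_eq.trans Module.finrank_prod

end FGGradedModule

/-! ### Weakly regular sequences on sums and on quotients by variables -/

theorem Submodule.ideal_smul_top_prod {R M N : Type*} [CommRing R] [AddCommGroup M] [Module R M]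
    [AddCommGroup N] [Module R N] (I : Ideal R) :
    I • (⊤ : Submodule R (M × N)) = (I • (⊤ : Submodule R M)).prod (I • (⊤ : Submodule R N)) := by
  apply le_antisymm
  · rw [Submodule.smul_le]
    intro r hr x _
    exact ⟨Submodule.smul_mem_smul hr trivial, Submodule.smul_mem_smul hr trivial⟩
  · rintro ⟨x, y⟩ ⟨hx, hy⟩
    have h1 : (I • (⊤ : Submodule R M)).map (LinearMap.inl R M N) ≤ I • ⊤ := by
      rw [Submodule.map_smul'']
      exact smul_mono_right _ le_top
    have h2 : (I • (⊤ : Submodule R N)).map (LinearMap.inr R M N) ≤ I • ⊤ := by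
      rw [Submodule.map_smul'']
      exact smul_mono_right _ le_top
    have := add_mem (h1 ⟨x, hx, rfl⟩) (h2 ⟨y, hy, rfl⟩)
    simpa using this

theorem RingTheory.Sequence.IsWeaklyRegular.prod {R M N : Type*} [CommRing R] [AddCommGroup M]
    [Module R M] [AddCommGroup N] [Module R N] {rs : List R}
    (hM : RingTheory.Sequence.IsWeaklyRegular M rs)
    (hN : RingTheory.Sequence.IsWeaklyRegular N rs) :
    RingTheory.Sequence.IsWeaklyRegular (M × N) rs := by
  refine ⟨fun i hi => ?_⟩
  have h1 := hM.1 i hi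
  have h2 := hN.1 i hi
  rw [isSMulRegular_quotient_iff_mem_of_smul_mem] at h1 h2 ⊢
  rw [Submodule.ideal_smul_top_prod]
  rintro ⟨x, y⟩ ⟨hx, hy⟩
  exact ⟨h1 x hx, h2 y hy⟩

theorem MvPolynomial.mem_span_X_image_of_X_mul_mem {R σ : Type*} [CommRing R] {B : Set σ} {u : σ}
    (hu : u ∉ B) {f : MvPolynomial σ R} (h : X u * f ∈ Ideal.span (X '' B)) :
    f ∈ Ideal.span (X '' B : Set (MvPolynomial σ R)) := by
  rw [mem_ideal_span_X_image] at h ⊢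
  intro m hm
  obtain ⟨i, hi, hmi⟩ := h (Finsupp.single u 1 + m) (by
    rw [mem_support_iff, coeff_X_mul]
    exact mem_support_iff.1 hm)
  refine ⟨i, hi, ?_⟩
  rwa [Finsupp.add_apply, Finsupp.single_eq_of_ne (by rintro rfl; exact hu hi), zero_add] at hmi

/-- Each intermediate quotient is again by an ideal generated by variables, and the next variable is
a new one. -/
theorem MvPolynomial.isWeaklyRegular_X_quotient {R σ : Type*} [CommRing R] {B : Set σ}
    {us : List σ} (hnd : us.Nodup) (hB : ∀ i ∈ us, i ∉ B) :
    RingTheory.Sequence.IsWeaklyRegular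
      (MvPolynomial σ R ⧸ Ideal.span (X '' B : Set (MvPolynomial σ R)))
      (us.map (X (R := R))) := by
  refine ⟨fun i hi => ?_⟩
  rw [isSMulRegular_quotient_iff_mem_of_smul_mem]
  set I := Ideal.span (X '' B : Set (MvPolynomial σ R))
  have key (f : MvPolynomial σ R) : (Submodule.mkQ I) f ∈
      Ideal.ofList ((us.map (X (R := R))).take i) • (⊤ : Submodule (MvPolynomial σ R) (MvPolynomial σ R ⧸ I)) ↔
      f ∈ Ideal.span (X '' (B ∪ {v | v ∈ us.take i}) : Set (MvPolynomial σ R)) := by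
    rw [← Submodule.mem_comap, Submodule.comap_smul_top_of_surjective _ _
      (Submodule.mkQ_surjective _), Submodule.ker_mkQ, smul_eq_mul, Ideal.mul_top, Set.image_union,
      Ideal.span_union, sup_comm]
    have : Ideal.ofList ((us.map (X (R := R))).take i) =
        Ideal.span (X '' {v | v ∈ us.take i} : Set (MvPolynomial σ R)) := by
      rw [Ideal.ofList]
      congr 1
      ext g
      simp [← List.map_take]
    rw [this]
  intro x hx
  obtain ⟨f, rfl⟩ := Submodule.mkQ_surjective I x
  rw [← map_smul, key, smul_eq_mul, List.getElem_map] at hx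
  rw [key]
  rw [List.length_map] at hi
  refine mem_span_X_image_of_X_mul_mem ?_ hx
  rintro (h | h)
  · exact hB _ (List.getElem_mem hi) h
  · obtain ⟨j, hj, hji⟩ := List.mem_take_iff_getElem.1 h
    have := (hnd.getElem_inj_iff).1 hji
    omega

/-! ### Hilbert functions of monomial quotients -/

namespace FGGradedModule
attribute [local instance] MvPolynomial.gradedAlgebra

variable {K : Type u} [Field K] {σ : Type v}

theorem mk_monomial_eq_smul (I : Ideal (MvPolynomial σ K)) (μ : σ →₀ ℕ) (c : K) :
    Ideal.Quotient.mk I (monomial μ c) = c • Ideal.Quotient.mk I (monomial μ 1) := by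
  rw [← Ideal.Quotient.mkₐ_eq_mk K, ← map_smul, smul_monomial, smul_eq_mul, mul_one]

theorem hilbertFunction_quotient (I : Ideal (MvPolynomial σ K))
    (hI : I.IsHomogeneous (homogeneousSubmodule σ K)) (d : ℤ) :
    (quotient I hI).hilbertFunction d = Module.finrank K (quotientGr I d) := rfl

/-- The monomials of degree `d` outside a monomial ideal form a basis of the degree `d` part of the
quotient. -/
theorem finrank_quotientGr_span_monomial (T : Set (σ →₀ ℕ)) {d : ℤ} (hd : 0 ≤ d)
    (B : Finset (σ →₀ ℕ)) (hB : ∀ μ, μ ∈ B ↔ μ.degree = d.toNat ∧ ∀ t ∈ T, ¬ t ≤ μ) :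
    Module.finrank K (quotientGr (Ideal.span ((fun t => monomial t (1 : K)) '' T)) d) =
      B.card := by
  classical
  set I := Ideal.span ((fun t => monomial t (1 : K)) '' T)
  let b : B → MvPolynomial σ K ⧸ I := fun μ => Ideal.Quotient.mk I (monomial μ.1 1)
  have hspan : quotientGr I d = Submodule.span K (Set.range b) := by
    rw [quotientGr, if_pos hd]
    apply le_antisymm
    · rintro _ ⟨f, hf, rfl⟩
      rw [AlgHom.toLinearMap_apply, Ideal.Quotient.mkₐ_eq_mk, f.as_sum, map_sum]
      refine Submodule.sum_mem _ fun μ hμ => ?_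
      have hdeg : μ.degree = d.toNat := by
        have := hf (mem_support_iff.1 hμ)
        rwa [Finsupp.degree_eq_weight_one]
      rw [mk_monomial_eq_smul]
      refine Submodule.smul_mem _ _ ?_
      by_cases hμB : μ ∈ B
      · exact Submodule.subset_span ⟨⟨μ, hμB⟩, rfl⟩
      · rw [hB] at hμB
        push Not at hμB
        obtain ⟨t, ht, htμ⟩ := hμB hdeg
        have : monomial μ (1 : K) ∈ I := by
          rw [mem_ideal_span_monomial_image]
          intro ν hν
          rw [Finset.mem_singleton.1 (support_monomial_subset hν)]
          exact ⟨t, ht, htμ⟩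
        rw [Ideal.Quotient.eq_zero_iff_mem.2 this]
        exact zero_mem _
    · rw [Submodule.span_le]
      rintro _ ⟨μ, rfl⟩
      exact ⟨_, isHomogeneous_monomial _ ((hB _).1 μ.2).1, rfl⟩
  have hli : LinearIndependent K b := by
    rw [linearIndependent_iff']
    intro s g hg μ hμ
    have hmem : ∑ ν ∈ s, monomial ν.1 (g ν) ∈ I := by
      rw [← Ideal.Quotient.eq_zero_iff_mem, map_sum, ← hg]
      exact Finset.sum_congr rfl fun ν _ => mk_monomial_eq_smul I ν.1 (g ν)
    rw [mem_ideal_span_monomial_image] at hmem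
    by_contra hne
    obtain ⟨t, ht, htμ⟩ := hmem μ.1 (by
      rw [mem_support_iff, coeff_sum]
      simp only [coeff_monomial]
      rw [Finset.sum_eq_single μ]
      · rwa [if_pos rfl]
      · intro ν _ hν
        exact if_neg fun h => hν (Subtype.ext h)
      · exact fun h => absurd hμ h)
    exact ((hB μ.1).1 μ.2).2 t ht htμ
  rw [hspan, finrank_span_eq_card hli, Fintype.card_coe]

theorem hilbertFunction_quotient_of_neg {I : Ideal (MvPolynomial σ K)}
    (hI : I.IsHomogeneous (homogeneousSubmodule σ K)) {d : ℤ} (hd : d < 0) :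
    (quotient I hI).hilbertFunction d = 0 := by
  rw [hilbertFunction_quotient, quotientGr, if_neg (by omega), finrank_bot]

theorem span_X_image_isHomogeneous (B : Set σ) :
    (Ideal.span (X '' B : Set (MvPolynomial σ K))).IsHomogeneous (homogeneousSubmodule σ K) := by
  refine Ideal.homogeneous_span _ _ ?_
  rintro _ ⟨i, _, rfl⟩
  exact ⟨1, isHomogeneous_X K i⟩

theorem hilbertFunction_quotient_X (A : Finset σ) (d : ℤ) :
    ((quotient (Ideal.span (X '' (A : Set σ)ᶜ : Set (MvPolynomial σ K)))
      (span_X_image_isHomogeneous _)).hilbertFunction d : ℤ) =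
      coeffInt (multichooseSeries A.card) d := by
  classical
  rcases lt_or_ge d 0 with hd | hd
  · rw [hilbertFunction_quotient_of_neg _ hd, coeffInt_of_neg _ hd, Nat.cast_zero]
  · have e : (X '' (A : Set σ)ᶜ : Set (MvPolynomial σ K)) =
        (fun t => monomial t (1 : K)) '' ((fun i => Finsupp.single i 1) '' (A : Set σ)ᶜ) := by
      rw [Set.image_image]
      rfl
    rw [hilbertFunction_quotient, e, finrank_quotientGr_span_monomial _ hd (A.finsuppAntidiag d.toNat),
      Finset.card_finsuppAntidiag_nat_eq_multichoose, coeffInt, if_pos hd, multichooseSeries,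
      PowerSeries.coeff_mk]
    intro μ
    rw [Finset.mem_finsuppAntidiag']
    refine and_congr Iff.rfl ?_
    rw [Set.forall_mem_image]
    constructor
    · intro h i hi hle
      have h1 := hle i
      rw [Finsupp.single_eq_same] at h1
      exact hi (h (Finsupp.mem_support_iff.2 (by omega)))
    · intro h i hi
      by_contra hiA
      refine h hiA (Finsupp.single_le_iff.2 ?_)
      have := Finsupp.mem_support_iff.1 hi
      omega

theorem hilbertFunction_quotient_top (d : ℤ) :
    (quotient (⊤ : Ideal (MvPolynomial σ K)) (Ideal.IsHomogeneous.top _)).hilbertFunction d = 0 := by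
  have : Subsingleton (MvPolynomial σ K ⧸ (⊤ : Ideal (MvPolynomial σ K))) :=
    Ideal.Quotient.subsingleton_iff.2 rfl
  have : Subsingleton (quotientGr (⊤ : Ideal (MvPolynomial σ K)) d) := inferInstance
  rw [hilbertFunction_quotient]
  exact Module.finrank_zero_of_subsingleton

/-- A sum of series `tˢ (1 - t)⁻ʲ` with `r ≤ j ≤ n` is the Hilbert series of a graded module over a
polynomial ring in at least `n` variables on which `r` of the variables form a regular sequence. -/
theorem exists_hilbertFunction_eq_of_mem_hilbertCone [Finite σ] (vs : List σ) (hvs : vs.Nodup)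
    {r : ℕ} {f : PowerSeries ℤ} (hf : f ∈ hilbertCone r vs.length) :
    ∃ M : FGGradedModule K σ, (∀ d, (M.hilbertFunction d : ℤ) = coeffInt f d) ∧
      RingTheory.Sequence.IsWeaklyRegular M.carrier ((vs.take r).map (X (R := K))) := by
  classical
  refine AddSubmonoid.closure_induction ?_ ?_ ?_ hf
  · rintro _ ⟨s, j, hrj, hj, rfl⟩
    -- Killing all but the first `j` listed variables leaves a polynomial ring in `j` variables;
    -- since `r ≤ j`, the first `r` survive.
    refine ⟨(quotient (Ideal.span (X '' ((vs.take j).toFinset : Set σ)ᶜ))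
      (span_X_image_isHomogeneous _)).shift s, fun d => ?_, ?_⟩
    · rw [hilbertFunction_shift, hilbertFunction_quotient_X, coeffInt_X_pow_mul,
        List.toFinset_card_of_nodup (hvs.sublist (List.take_sublist _ _)), List.length_take,
        min_eq_left hj]
    · refine isWeaklyRegular_X_quotient (hvs.sublist (List.take_sublist _ _)) fun i hi hic => hic ?_
      rw [Finset.mem_coe, List.mem_toFinset]
      exact List.take_subset_take_left vs hrj hi
  · refine ⟨quotient ⊤ (Ideal.IsHomogeneous.top _), fun d => ?_, ⟨fun i hi => ?_⟩⟩
    · rw [hilbertFunction_quotient_top, coeffInt]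
      simp
    · rw [isSMulRegular_quotient_iff_mem_of_smul_mem]
      intro x _
      have : Subsingleton (MvPolynomial σ K ⧸ (⊤ : Ideal (MvPolynomial σ K))) :=
        Ideal.Quotient.subsingleton_iff.2 rfl
      rw [show x = 0 from this.elim _ _]
      exact zero_mem _
  · rintro f g - - ⟨M, hM, hMr⟩ ⟨N, hN, hNr⟩
    refine ⟨M.prod N, fun d => ?_, hMr.prod hNr⟩
    rw [hilbertFunction_prod, Nat.cast_add, hM, hN, coeffInt_add]

end FGGradedModule

section

attribute [local instance] MvPolynomial.gradedAlgebra

theorem hilbertFunction_bipartite (K : Type u) [Field K] (n m : ℕ) (d : ℤ) :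
    ((FGGradedModule.quotient (bipartiteEdgeIdeal K n m)
      (bipartiteEdgeIdeal_isHomogeneous K n m)).hilbertFunction d : ℤ) =
      coeffInt (bipartiteSeries n m) d := by
  classical
  rcases lt_or_ge d 0 with hd | hd
  · rw [FGGradedModule.hilbertFunction_quotient_of_neg _ hd, coeffInt_of_neg _ hd, Nat.cast_zero]
  set T : Set (Fin n ⊕ Fin m →₀ ℕ) :=
    {t | ∃ i j, t = Finsupp.single (Sum.inl i) 1 + Finsupp.single (Sum.inr j) 1}
  have e : bipartiteEdgeIdeal K n m = Ideal.span ((fun t => monomial t (1 : K)) '' T) := by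
    rw [bipartiteEdgeIdeal]
    congr 1
    ext f
    constructor
    · rintro ⟨i, j, rfl⟩
      refine ⟨_, ⟨i, j, rfl⟩, ?_⟩
      simp [X, monomial_mul]
    · rintro ⟨_, ⟨i, j, rfl⟩, rfl⟩
      refine ⟨i, j, ?_⟩
      simp [X, monomial_mul]
  set A : Finset (Fin n ⊕ Fin m) := Finset.univ.map Function.Embedding.inl
  set B : Finset (Fin n ⊕ Fin m) := Finset.univ.map Function.Embedding.inr
  have hA (x) : x ∈ A ↔ x.isLeft := by cases x <;> simp [A]
  have hB (x) : x ∈ B ↔ x.isRight := by cases x <;> simp [B]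
  rw [FGGradedModule.hilbertFunction_quotient, e, FGGradedModule.finrank_quotientGr_span_monomial T hd
    (A.finsuppAntidiag d.toNat ∪ B.finsuppAntidiag d.toNat)]
  -- Monomials pure in the `x`'s and in the `y`'s share only `1`; writing the overlap with zero
  -- variables matches the term `-1 = -(1 - t)⁰`.
  · have hinter : A.finsuppAntidiag d.toNat ∩ B.finsuppAntidiag d.toNat =
        (∅ : Finset (Fin n ⊕ Fin m)).finsuppAntidiag d.toNat := by
      ext μ
      simp only [Finset.mem_inter, Finset.mem_finsuppAntidiag', Finset.subset_empty]
      constructor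
      · rintro ⟨⟨h1, h2⟩, -, h3⟩
        refine ⟨h1, Finset.eq_empty_of_forall_notMem fun x hx => ?_⟩
        have hx1 := (hA x).1 (h2 hx)
        have hx2 := (hB x).1 (h3 hx)
        cases x <;> simp_all
      · rintro ⟨h1, h2⟩
        simp [h1, h2]
    have hcard := Finset.card_union_add_card_inter (A.finsuppAntidiag d.toNat)
      (B.finsuppAntidiag d.toNat)
    rw [hinter] at hcard
    simp only [Finset.card_finsuppAntidiag_nat_eq_multichoose] at hcard
    rw [show A.card = n by simp [A], show B.card = m by simp [B], Finset.card_empty] at hcard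
    rw [coeffInt, if_pos hd, bipartiteSeries, ← multichooseSeries_zero, map_sub, map_add]
    simp only [multichooseSeries, PowerSeries.coeff_mk]
    omega
  · intro μ
    simp only [Finset.mem_union, Finset.mem_finsuppAntidiag', ← and_or_left]
    refine and_congr Iff.rfl ?_
    constructor
    · rintro h _ ⟨i, j, rfl⟩ hle
      have h1 := hle (Sum.inl i)
      have h2 := hle (Sum.inr j)
      simp only [Finsupp.add_apply, Finsupp.single_eq_same, ne_eq, reduceCtorEq,
        not_false_eq_true, Finsupp.single_eq_of_ne, add_zero, zero_add] at h1 h2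
      rcases h with h | h
      · have := (hA _).1 (h (Finsupp.mem_support_iff.2 (show μ (Sum.inr j) ≠ 0 by omega)))
        simp at this
      · have := (hB _).1 (h (Finsupp.mem_support_iff.2 (show μ (Sum.inl i) ≠ 0 by omega)))
        simp at this
    · intro h
      by_contra! hcon
      obtain ⟨x, hx, hxA⟩ := Finset.not_subset.1 hcon.1
      obtain ⟨y, hy, hyB⟩ := Finset.not_subset.1 hcon.2
      rw [hA] at hxA
      rw [hB] at hyB
      rw [Finsupp.mem_support_iff] at hx hy
      rcases x with i | j
      · simp at hxA
      rcases y with i | j'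
      · refine h _ ⟨i, j, rfl⟩ fun z => ?_
        rcases z with i' | j'
        · rcases eq_or_ne i i' with rfl | hne
          · simp
            omega
          · simp [hne.symm]
        · rcases eq_or_ne j j' with rfl | hne
          · simp
            omega
          · simp [hne.symm]
      · simp at hyB

end

/-! ### The Hilbert depth criterion and the theorem -/

theorem RingTheory.Sequence.IsRegular.take {R M : Type*} [CommRing R] [AddCommGroup M] [Module R M]
    {rs : List R} (h : RingTheory.Sequence.IsRegular M rs) (k : ℕ) :
    RingTheory.Sequence.IsRegular M (rs.take k) := by
  have h1 := h.1
  rw [← List.take_append_drop k rs, RingTheory.Sequence.isWeaklyRegular_append_iff] at h1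
  refine ⟨h1.1, fun h2 => h.2 (le_antisymm (h2.le.trans ?_) le_top)⟩
  exact Submodule.smul_mono_left (Ideal.span_mono fun _ hr => List.mem_of_mem_take hr)

theorem FGGradedModule.exists_isRegular_of_lt_hdepth {K : Type u} [Field K] {σ : Type v}
    {M : FGGradedModule K σ} {s : ℕ} (h : (s : ℕ∞) < M.hdepth) :
    ∃ (N : FGGradedModule K σ) (rs : List (MvPolynomial σ K)),
      N.hilbertFunction = M.hilbertFunction ∧ rs.length = s + 1 ∧
      (∀ r ∈ rs, r ∈ idealOfVars σ K) ∧ RingTheory.Sequence.IsRegular N.carrier rs := by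
  simp only [FGGradedModule.hdepth, FGGradedModule.depth, lt_iSup_iff] at h
  obtain ⟨N, hN, rs, ⟨hrs, hreg⟩, hs⟩ := h
  rw [Nat.cast_lt] at hs
  exact ⟨N, rs.take (s + 1), hN, by rw [List.length_take, min_eq_left hs],
    fun r hr => hrs r (List.mem_of_mem_take hr), hreg.take _⟩

theorem FGGradedModule.length_le_hdepth {K : Type u} [Field K] {σ : Type v}
    {M N : FGGradedModule K σ} (hN : N.hilbertFunction = M.hilbertFunction)
    {rs : List (MvPolynomial σ K)} (hrs : ∀ r ∈ rs, r ∈ idealOfVars σ K)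
    (hreg : RingTheory.Sequence.IsRegular N.carrier rs) : (rs.length : ℕ∞) ≤ M.hdepth :=
  le_iSup₂_of_le N hN (le_iSup₂_of_le rs ⟨hrs, hreg⟩ le_rfl)

theorem natCast_le_bipartiteHdepth_iff (K : Type u) [Field K] {n m r : ℕ} (hm : m ≤ n) :
    (r : ℕ∞) ≤ bipartiteHdepth K n m ↔ BipartiteAdmissible n m r := by
  constructor
  · intro h
    rcases r with _ | s
    · exact .of_two_mul_le (by omega) (by omega)
    have hlt : (s : ℕ∞) < bipartiteHdepth K n m :=
      lt_of_lt_of_le (Nat.cast_lt.2 s.lt_succ_self) h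
    obtain ⟨N, rs, hN, hlen, hrs, hreg⟩ := FGGradedModule.exists_isRegular_of_lt_hdepth hlt
    refine bipartiteAdmissible_of_coeff_nonneg hm fun k => ?_
    rw [← hlen]
    refine N.coeff_nonneg_of_isRegular (fun d => ?_) hrs hreg k
    rw [hN, hilbertFunction_bipartite]
  · intro h
    set vs : List (Fin n ⊕ Fin m) := List.ofFn Sum.inl
    have hvs : vs.Nodup := List.nodup_ofFn.2 Sum.inl_injective
    have hlen : vs.length = n := List.length_ofFn
    obtain ⟨N, hN, hreg⟩ := FGGradedModule.exists_hilbertFunction_eq_of_mem_hilbertCone (K := K)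
      vs hvs (r := r) (f := bipartiteSeries n m) (by
        rw [hlen]
        exact h.bipartiteSeries_mem_hilbertCone hm)
    have hmem : ∀ f ∈ (vs.take r).map (X (R := K)), f ∈ idealOfVars (Fin n ⊕ Fin m) K := by
      intro f hf
      obtain ⟨i, -, rfl⟩ := List.mem_map.1 hf
      exact Ideal.subset_span ⟨i, rfl⟩
    -- Nonzero because the Hilbert function is `1` in degree `0`; graded Nakayama then upgrades weak
    -- regularity to regularity.
    have hnt : Nontrivial N.carrier := by
      by_contra hsub
      rw [not_nontrivial_iff_subsingleton] at hsub
      have h0 := hN 0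
      have : coeffInt (bipartiteSeries n m) 0 = 1 := by
        simp [coeffInt, bipartiteSeries, multichooseSeries]
      rw [this, FGGradedModule.hilbertFunction, Module.finrank_zero_of_subsingleton] at h0
      exact absurd h0 (by norm_num)
    have hle := FGGradedModule.length_le_hdepth
      (M := FGGradedModule.quotient (bipartiteEdgeIdeal K n m)
        (bipartiteEdgeIdeal_isHomogeneous K n m)) (N := N)
      (funext fun d => Nat.cast_injective (R := ℤ) (by rw [hN, hilbertFunction_bipartite]))
      hmem ⟨hreg, fun htop => N.projections.idealOfVars_smul_top_ne_top
        (top_le_iff.1 (htop.le.trans (Submodule.smul_mono_left (Ideal.span_le.2 hmem))))⟩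
    rwa [List.length_map, List.length_take, hlen, min_eq_left h.1] at hle

theorem bipartiteHdepth_le_bipartiteHdepth (K : Type u) [Field K] {n m m' : ℕ} (hm : m ≤ n)
    (hm' : m' ≤ n) (h : ∀ r, BipartiteAdmissible n m r → BipartiteAdmissible n m' r) :
    bipartiteHdepth K n m ≤ bipartiteHdepth K n m' :=
  ENat.forall_natCast_le_iff_le.1 fun r hr =>
    (natCast_le_bipartiteHdepth_iff K hm').2 (h r ((natCast_le_bipartiteHdepth_iff K hm).1 hr))

theorem bipartiteHdepth_middle (K : Type u) [Field K] {n m : ℕ} (hn : 1 ≤ n)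
    (h1 : 2 * m ≤ n + 1) (h2 : n ≤ 2 * m + 1) :
    bipartiteHdepth K n m = ((n + 1) / 2 : ℕ) := by
  apply le_antisymm
  · refine ENat.forall_natCast_le_iff_le.1 fun r hr => ?_
    have := ((natCast_le_bipartiteHdepth_iff K (by omega)).1 hr).two_mul_le h1 h2
    rw [Nat.cast_le]
    omega
  · exact (natCast_le_bipartiteHdepth_iff K (by omega)).2
      (.of_two_mul_le (by omega) (by omega))

theorem theorem3p3 (K : Type u) [Field K] (n : ℕ) (hn : 1 ≤ n) :
    (∀ m m' : ℕ, 1 ≤ m → m ≤ m' → m' ≤ ⌊(n : ℚ) / 2⌋₊ →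
      bipartiteHdepth K n m' ≤ bipartiteHdepth K n m) ∧
    (∀ m m' : ℕ, ⌈(n : ℚ) / 2⌉₊ ≤ m → m ≤ m' → m' ≤ n →
      bipartiteHdepth K n m ≤ bipartiteHdepth K n m') ∧
    (bipartiteHdepth K n ⌊(n : ℚ) / 2⌋₊ = (⌈(n : ℚ) / 2⌉₊ : ℕ∞) ∧
      bipartiteHdepth K n ⌈(n : ℚ) / 2⌉₊ = (⌈(n : ℚ) / 2⌉₊ : ℕ∞)) ∧
    (∀ m : ℕ, 1 ≤ m → m ≤ ⌊(n : ℚ) / 2⌋₊ →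
      bipartiteHdepth K n (n - m) ≤ bipartiteHdepth K n m) ∧
    (∀ m : ℕ, 1 ≤ m → m ≤ n →
      (⌊(n : ℚ) / 2⌋₊ : ℕ∞) ≤ bipartiteHdepth K n m ∧
        bipartiteHdepth K n m ≤ bipartiteHdepth K n 1) := by
  have hfloor : ⌊(n : ℚ) / 2⌋₊ = n / 2 := Nat.floor_div_ofNat (n : ℚ) 2 |>.trans (by simp)
  have hceil : ⌈(n : ℚ) / 2⌉₊ = (n + 1) / 2 := by
    refine eq_of_forall_ge_iff fun k => ?_
    rw [Nat.ceil_le, div_le_iff₀ (by norm_num)]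
    norm_cast
    omega
  rw [hfloor, hceil]
  refine ⟨fun m m' h1 h2 h3 => ?_, fun m m' h1 h2 h3 => ?_, ⟨?_, ?_⟩, fun m h1 h2 => ?_,
    fun m h1 h2 => ⟨?_, ?_⟩⟩
  · exact bipartiteHdepth_le_bipartiteHdepth K (by omega) (by omega) fun r h =>
      h.antitone h2 (by omega)
  · exact bipartiteHdepth_le_bipartiteHdepth K (by omega) (by omega) fun r h =>
      h.monotone (by omega) h2 (by omega)
  · exact bipartiteHdepth_middle K hn (by omega) (by omega)
  · exact bipartiteHdepth_middle K hn (by omega) (by omega)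
  · exact bipartiteHdepth_le_bipartiteHdepth K (by omega) (by omega) fun r h =>
      h.of_sub h1 (by omega)
  · exact (natCast_le_bipartiteHdepth_iff K h2).2 (.of_two_mul_le (by omega) (by omega))
  · exact bipartiteHdepth_le_bipartiteHdepth K h2 hn fun r h => h.le_one h1 h2
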